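/- **Path-cover lemma.** A $k$-graph $H$ consists of a finite vertex set $V(H)$ and a set of edges, each edge being a $k$-element subset of $V(H)$. Its minimum codegree $\delta_{k-1}(H)$ is the minimum, over all $(k-1)$-element sets $S\subseteq V(H)$, of the number of edges containing $S$; for $B\subseteq V(H)$, $e_H(B)$ denotes the number of edges contained in $B$. For $1\le \ell<k$, an $\ell$-path is a $k$-graph with at least one edge whose vertices can be ordered as $v_1,\dots,v_t$ (all distinct), where $t=\ell+q(k-\ell)$ and $q\ge 1$, such that its edges are exactly the $q$ sets $\{v_{i(k-\ell)+1},\dots,v_{i(k-\ell)+k}\}$, $0\le i<q$ (so every edge consists of $k$ consecutive vertices and any two consecutive edges share exactly $\ell$ vertices). For $\Delta>0$, a $k$-graph $H$ on $n$ vertices is $\Delta$-extremal (with respect to $\ell$) if there is a set $B\subseteq V(H)$ with $|B|=\left\lfloor \frac{2(k-\ell)-1}{2(k-\ell)}\,n\right\rfloor$ and $e_H(B)\le \Delta n^k$. For all integers $k\ge 3$ and $1\le \ell<k/2$, and all real $\gamma_3,\alpha>0$, there exist integers $p$ and $n_0$ (depending only on $k,\ell,\gamma_3,\alpha$) such that the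 following holds. Let $H$ be a $k$-graph on $n>n_0$ vertices with $$\delta_{k-1}(H)\ \ge\ \Bigl(\frac{1}{2(k-\ell)}-\gamma_3\Bigr)n .$$ Then either there is a family of at most $p$ pairwise vertex-disjoint $\ell$-paths in $H$ that together cover all but at most $\alpha n$ vertices of $H$, or $H$ is $14\gamma_3$-extremal. -/

import Mathlib

/-- A `k`-uniform hypergraph (`k`-graph) with finite vertex set `verts` (a set of elements of an
ambient type `V`) and finite edge set `edges`, every edge being a `k`-element subset of `verts`. -/
structure KGraph (V : Type*) (k : ℕ) where
  verts : Finset V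
  edges : Finset (Finset V)
  edge_subset : ∀ e ∈ edges, e ⊆ verts
  edge_card : ∀ e ∈ edges, e.card = k

namespace KGraph

/-- `P` is a subhypergraph of `H`. -/
def IsSubgraph {V : Type*} {k : ℕ} (P H : KGraph V k) : Prop :=
  P.verts ⊆ H.verts ∧ P.edges ⊆ H.edges

/-- `deg_H(S)`: the number of edges of `H` containing `S`. -/
def degree {V : Type*} [DecidableEq V] {k : ℕ} (H : KGraph V k) (S : Finset V) : ℕ :=
  (H.edges.filter (fun e => S ⊆ e)).card

/-- `δ_d(H)`: the minimum of `deg_H(S)` over all `d`-element sets `S` of vertices of `H`. -/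
noncomputable def minDegree {V : Type*} [DecidableEq V] {k : ℕ} (H : KGraph V k) (d : ℕ) : ℕ :=
  sInf {m : ℕ | ∃ S : Finset V, S ⊆ H.verts ∧ S.card = d ∧ H.degree S = m}

/-- `e_H(B)`: the number of edges of `H` contained in `B`. -/
def edgesIn {V : Type*} [DecidableEq V] {k : ℕ} (H : KGraph V k) (B : Finset V) : ℕ :=
  (H.edges.filter (fun e => e ⊆ B)).card

/-- `H` is `Δ`-extremal (with respect to `ℓ`): some set `B` of exactly
`⌊(2(k-ℓ)-1)/(2(k-ℓ)) * n⌋` vertices spans at most `Δ * n^k` edges, where `n = |V(H)|`. -/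
def IsExtremal {V : Type*} [DecidableEq V] {k : ℕ} (H : KGraph V k) (ℓ : ℕ) (Δ : ℝ) : Prop :=
  ∃ B : Finset V, B ⊆ H.verts ∧
    B.card = ⌊(2 * ((k : ℝ) - ℓ) - 1) / (2 * ((k : ℝ) - ℓ)) * (H.verts.card : ℝ)⌋₊ ∧
    (H.edgesIn B : ℝ) ≤ Δ * (H.verts.card : ℝ) ^ k

/-- `P` is an `ℓ`-path (with `q ≥ 1` edges): its vertices can be listed without repetition as
`v 0, …, v (t - 1)`, where `t = ℓ + q * (k - ℓ)`, so that its edges are exactly the `q` blocks of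
`k` consecutive vertices starting at the positions `0, k - ℓ, 2 * (k - ℓ), …`. Thus two consecutive
edges share exactly `ℓ` vertices. -/
def IsPath {V : Type*} [DecidableEq V] {k : ℕ} (P : KGraph V k) (ℓ : ℕ) : Prop :=
  ∃ (q : ℕ) (v : ℕ → V), 1 ≤ q ∧
    Set.InjOn v (Set.Iio (ℓ + q * (k - ℓ))) ∧
    P.verts = (Finset.range (ℓ + q * (k - ℓ))).image v ∧
    P.edges = (Finset.range q).image
      (fun i => (Finset.Ico (i * (k - ℓ)) (i * (k - ℓ) + k)).image v)

end KGraph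

/-! The cover is improved round by round, without a regularity lemma. If `H` is not extremal, then
any disjoint union `X` of `p` paths that misses at least `α n` vertices can be replaced by a union
of `g p` paths covering at least `c n` more vertices, where `c` and `g` do not depend on `H`
(`exists_covered_step`). After more than `1 / c` rounds this must stop, which bounds the number of
paths.

For one round, put `t = 2(k - ℓ)` and cut the vertex set into a constant number `K` of parts `W i`
of size about `n / K`, along the paths of `X`, so that each part carries its own pieces `Y i` of
paths (`Covered.exists_partition`). Let `U` be the set of vertices in no `Y i`, and `A` the set of
vertices lying in many edges whose other vertices are in `U`. Double counting against the codegree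
gives `|A| ≥ (1/t - γ - γ/24) n` (`card_large_degree_ge`). Select a set `J` of at most `k` parts
with union `W_J`, and discard their pieces. Almost all of `A ∩ W_J` can be covered by long paths
with all other vertices in `U \ W_J`; such a path spends one vertex of `A` on every two edges, so
each vertex of `A` pays for `t` covered vertices (`exists_long_path`,
`exists_cover_of_large_degree`). Further paths `Q` inside `W_J \ A` hit almost every edge there
(`exists_cover_sparse`).

Up to small errors the exchange gains at least `t |A ∩ W_J| + |Q| - |W_J|`. If no exchange gains `c
n`, single parts show that `|A|` is at most about `n / t`. Moreover `|Q|` is at most about `|W_J| -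
t |A ∩ W_J|`; averaged over all `k`-tuples of parts, this bounds the edges avoiding `A`, since such
an edge is either among the few missed by `Q` or meets `Q`. Hence the complement of `A`, adjusted to
the prescribed size, is a sparse set witnessing extremality (`isExtremal_of_no_gain`). -/

namespace KGraph

/-! ### Vertex sets of paths: disjoint unions, cutting and extension -/

section Paths

variable {V : Type*} [DecidableEq V] {k : ℕ}

/-- `v 0, …, v (ℓ + q * (k - ℓ) - 1)` lists the vertices of an `ℓ`-path with `q` edges in `H`;
the degenerate case `q = 0` of `ℓ` distinct vertices is allowed. -/
def IsPathSeq (H : KGraph V k) (ℓ q : ℕ) (v : ℕ → V) : Prop :=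
  Set.InjOn v (Set.Iio (ℓ + q * (k - ℓ))) ∧
  (∀ i < ℓ + q * (k - ℓ), v i ∈ H.verts) ∧
  ∀ i < q, (Finset.Ico (i * (k - ℓ)) (i * (k - ℓ) + k)).image v ∈ H.edges

/-- `Z` is the vertex set of an `ℓ`-path in `H`. -/
def IsPathSet (H : KGraph V k) (ℓ : ℕ) (Z : Finset V) : Prop :=
  ∃ (q : ℕ) (v : ℕ → V), 1 ≤ q ∧ H.IsPathSeq ℓ q v ∧
    (Finset.range (ℓ + q * (k - ℓ))).image v = Z

/-- `X` is a disjoint union of the vertex sets of at most `p` many `ℓ`-paths in `H`. -/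
inductive Covered (H : KGraph V k) (ℓ : ℕ) : ℕ → Finset V → Prop
  | nil (p : ℕ) : Covered H ℓ p ∅
  | cons {p : ℕ} {X Z : Finset V} : Covered H ℓ p X → H.IsPathSet ℓ Z → Disjoint X Z →
      Covered H ℓ (p + 1) (X ∪ Z)

theorem block_lt {k ℓ i q j : ℕ} (hℓk : ℓ ≤ k) (hi : i < q) (hj : j < i * (k - ℓ) + k) :
    j < ℓ + q * (k - ℓ) := by
  have h1 : (i + 1) * (k - ℓ) ≤ q * (k - ℓ) := Nat.mul_le_mul_right _ hi
  rw [add_mul, one_mul] at h1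
  omega

theorem IsPathSet.subset_verts {H : KGraph V k} {ℓ : ℕ} {Z : Finset V} (h : H.IsPathSet ℓ Z) :
    Z ⊆ H.verts := by
  obtain ⟨q, v, -, hv, rfl⟩ := h
  intro z hz
  obtain ⟨i, hi, rfl⟩ := Finset.mem_image.1 hz
  exact hv.2.1 i (Finset.mem_range.1 hi)

theorem IsPathSet.exists_path {H : KGraph V k} {ℓ : ℕ} (hℓk : ℓ ≤ k) {Z : Finset V}
    (h : H.IsPathSet ℓ Z) : ∃ P : KGraph V k, P.IsSubgraph H ∧ P.IsPath ℓ ∧ P.verts = Z := by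
  have hZ := h.subset_verts
  obtain ⟨q, v, hq, hv, rfl⟩ := h
  have hE : ∀ e ∈ (Finset.range q).image
      (fun i => (Finset.Ico (i * (k - ℓ)) (i * (k - ℓ) + k)).image v), e ∈ H.edges := by
    intro e he
    obtain ⟨i, hi, rfl⟩ := Finset.mem_image.1 he
    exact hv.2.2 i (Finset.mem_range.1 hi)
  refine ⟨⟨_, (Finset.range q).image
      (fun i => (Finset.Ico (i * (k - ℓ)) (i * (k - ℓ) + k)).image v), ?_,
      fun e he => H.edge_card e (hE e he)⟩, ⟨hZ, hE⟩, ⟨q, v, hq, hv.1, rfl, rfl⟩, rfl⟩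
  intro e he
  obtain ⟨i, hi, rfl⟩ := Finset.mem_image.1 he
  apply Finset.image_subset_image
  intro j hj
  exact Finset.mem_range.2 (block_lt hℓk (Finset.mem_range.1 hi) (Finset.mem_Ico.1 hj).2)

theorem Covered.subset_verts {H : KGraph V k} {ℓ p : ℕ} {X : Finset V} (h : H.Covered ℓ p X) :
    X ⊆ H.verts := by
  induction h with
  | nil p => simp
  | cons _ hZ _ ih => exact Finset.union_subset ih hZ.subset_verts

theorem Covered.exists_family {H : KGraph V k} {ℓ p : ℕ} (hℓk : ℓ ≤ k) {X : Finset V}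
    (h : H.Covered ℓ p X) : ∃ F : Finset (KGraph V k),
      F.card ≤ p ∧ (∀ P ∈ F, P.IsSubgraph H ∧ P.IsPath ℓ) ∧
      (∀ P ∈ F, ∀ Q ∈ F, P ≠ Q → Disjoint P.verts Q.verts) ∧ F.biUnion KGraph.verts = X := by
  classical
  induction h with
  | nil p => exact ⟨∅, by simp⟩
  | @cons p X Z _ hZ hXZ ih =>
    obtain ⟨F, hF, hp, hd, rfl⟩ := ih
    obtain ⟨P, hP1, hP2, rfl⟩ := hZ.exists_path hℓk
    have hdis : ∀ Q ∈ F, Disjoint Q.verts P.verts := fun Q hQ =>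
      Finset.disjoint_of_subset_left (Finset.subset_biUnion_of_mem KGraph.verts hQ) hXZ
    refine ⟨insert P F, (Finset.card_insert_le _ _).trans (by omega), ?_, ?_, ?_⟩
    · intro Q hQ
      rcases Finset.mem_insert.1 hQ with rfl | hQ
      exacts [⟨hP1, hP2⟩, hp Q hQ]
    · intro Q hQ Q' hQ' hne
      rcases Finset.mem_insert.1 hQ with h | h <;> rcases Finset.mem_insert.1 hQ' with h' | h'
      · exact absurd (h.trans h'.symm) hne
      · exact h ▸ (hdis _ h').symm
      · exact h' ▸ hdis _ h
      · exact hd _ h _ h' hne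
    · rw [Finset.biUnion_insert, Finset.union_comm]

theorem Covered.mono {H : KGraph V k} {ℓ p p' : ℕ} {X : Finset V} (h : H.Covered ℓ p X)
    (hp : p ≤ p') : H.Covered ℓ p' X := by
  induction h generalizing p' with
  | nil p => exact .nil _
  | @cons p X Z _ hZ hXZ ih =>
    obtain ⟨p', rfl⟩ : ∃ r, p' = r + 1 := ⟨p' - 1, by omega⟩
    exact .cons (ih (by omega)) hZ hXZ

theorem Covered.union {H : KGraph V k} {ℓ p p' : ℕ} {X Y : Finset V} (hX : H.Covered ℓ p X)
    (hY : H.Covered ℓ p' Y) (hXY : Disjoint X Y) : H.Covered ℓ (p + p') (X ∪ Y) := by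
  induction hY with
  | nil p' => simpa using hX.mono (by omega)
  | @cons p' Y Z _ hZ hYZ ih =>
    rw [Finset.disjoint_union_right] at hXY
    rw [← Finset.union_assoc, ← add_assoc]
    exact .cons (ih hXY.1) hZ (Finset.disjoint_union_left.2 ⟨hXY.2, hYZ⟩)

theorem IsPathSet.covered {H : KGraph V k} {ℓ : ℕ} {Z : Finset V} (h : H.IsPathSet ℓ Z) :
    H.Covered ℓ 1 Z := by
  simpa using Covered.cons (.nil 0) h (Finset.disjoint_empty_left _)

theorem Covered.biUnion {H : KGraph V k} {ℓ p : ℕ} {ι : Type*} (s : Finset ι)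
    (X : ι → Finset V) (hX : ∀ i ∈ s, H.Covered ℓ p (X i))
    (hd : ∀ i ∈ s, ∀ j ∈ s, i ≠ j → Disjoint (X i) (X j)) :
    H.Covered ℓ (s.card * p) (s.biUnion X) := by
  classical
  induction s using Finset.induction_on with
  | empty => simpa using Covered.nil 0
  | insert a s ha ih =>
    rw [Finset.biUnion_insert, Finset.card_insert_of_notMem ha, Finset.union_comm, add_mul, one_mul]
    refine (ih (fun i hi => hX i (Finset.mem_insert_of_mem hi)) fun i hi j hj =>
      hd i (Finset.mem_insert_of_mem hi) j (Finset.mem_insert_of_mem hj)).union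
      (hX a (Finset.mem_insert_self _ _)) ?_
    rw [Finset.disjoint_biUnion_left]
    intro i hi
    exact hd i (Finset.mem_insert_of_mem hi) a (Finset.mem_insert_self _ _)
      (fun h => ha (h ▸ hi))

theorem IsPathSeq.isPathSet_prefix {H : KGraph V k} {ℓ q a : ℕ} {v : ℕ → V}
    (hv : H.IsPathSeq ℓ q v) (ha : 1 ≤ a) (haq : a ≤ q) :
    H.IsPathSet ℓ ((Finset.range (ℓ + a * (k - ℓ))).image v) := by
  have h1 : a * (k - ℓ) ≤ q * (k - ℓ) := Nat.mul_le_mul_right _ haq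
  refine ⟨a, v, ha, ⟨hv.1.mono fun i hi => ?_, fun i hi => hv.2.1 i (by omega),
    fun i hi => hv.2.2 i (by omega)⟩, rfl⟩
  simp only [Set.mem_Iio] at hi ⊢
  omega

theorem IsPathSeq.isPathSet_suffix {H : KGraph V k} {ℓ q b : ℕ} {v : ℕ → V}
    (hv : H.IsPathSeq ℓ q v) (hb : b < q) :
    H.IsPathSet ℓ ((Finset.Ico (b * (k - ℓ)) (ℓ + q * (k - ℓ))).image v) := by
  have h1 : (q - b) * (k - ℓ) + b * (k - ℓ) = q * (k - ℓ) := by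
    rw [← add_mul]; congr 1; omega
  refine ⟨q - b, fun i => v (i + b * (k - ℓ)), by omega, ⟨?_, fun i hi => hv.2.1 _ (by omega), ?_⟩, ?_⟩
  · intro i hi j hj hij
    simp only [Set.mem_Iio] at hi hj
    have := hv.1 (Set.mem_Iio.2 (show i + b * (k - ℓ) < _ by omega))
      (Set.mem_Iio.2 (show j + b * (k - ℓ) < _ by omega)) hij
    omega
  · intro i hi
    have := hv.2.2 (i + b) (by omega)
    convert this using 1
    rw [show (fun i => v (i + b * (k - ℓ))) = v ∘ (fun i => i + b * (k - ℓ)) from rfl,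
      ← Finset.image_image]
    rw [Finset.image_add_right_Ico]
    congr 2 <;> ring
  · rw [show (fun i => v (i + b * (k - ℓ))) = v ∘ (fun i => i + b * (k - ℓ)) from rfl,
      ← Finset.image_image, Finset.range_eq_Ico, Finset.image_add_right_Ico]
    congr 2 <;> omega

/-- Cut the vertex order after position `y`. The edges lying wholly on one side of the cut form a
path again, and rounding to complete edges loses at most `k` vertices on each side. -/
theorem IsPathSet.split {H : KGraph V k} {ℓ : ℕ} (hℓk : ℓ < k) {Z : Finset V}
    (h : H.IsPathSet ℓ Z) {y : ℕ} (hy : y ≤ Z.card) :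
    ∃ Y X₁ X₂ : Finset V, Y ⊆ Z ∧ Y.card = y ∧ X₁ ⊆ Y ∧ X₂ ⊆ Z \ Y ∧ H.Covered ℓ 1 X₁ ∧
      H.Covered ℓ 1 X₂ ∧ Z.card ≤ X₁.card + X₂.card + 2 * k := by
  obtain ⟨q, v, hq, hv, rfl⟩ := h
  have hcard : ∀ s : Finset ℕ, s ⊆ Finset.range (ℓ + q * (k - ℓ)) → (s.image v).card = s.card := by
    intro s hs
    apply Finset.card_image_of_injOn
    exact hv.1.mono fun i hi => Finset.mem_range.1 (hs hi)
  rw [hcard _ subset_rfl, Finset.card_range] at hy ⊢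
  have hys : Finset.range y ⊆ Finset.range (ℓ + q * (k - ℓ)) := Finset.range_subset_range.2 hy
  obtain ⟨d, hd⟩ : ∃ d, d = k - ℓ := ⟨_, rfl⟩
  have hd0 : 0 < d := by omega
  have first : ∃ X₁ ⊆ (Finset.range y).image v, H.Covered ℓ 1 X₁ ∧ y ≤ X₁.card + k := by
    rcases lt_or_ge y k with h | h
    · exact ⟨∅, by simp, .nil _, by omega⟩
    have h1 := Nat.div_add_mod (y - ℓ) d
    have h2 := Nat.mod_lt (y - ℓ) hd0
    have h3 : 1 ≤ (y - ℓ) / d := (Nat.one_le_div_iff hd0).2 (by omega)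
    have h4 : (y - ℓ) / d ≤ q := by
      apply Nat.div_le_of_le_mul
      rw [mul_comm, hd]; omega
    have h5 : ℓ + (y - ℓ) / d * (k - ℓ) ≤ y := by rw [← hd, mul_comm]; omega
    refine ⟨_, Finset.image_subset_image (Finset.range_subset_range.2 h5),
      (hv.isPathSet_prefix h3 h4).covered, ?_⟩
    rw [hcard _ (Finset.range_subset_range.2 (h5.trans hy)), Finset.card_range, ← hd,
      mul_comm ((y - ℓ) / d)]
    omega
  have second : ∃ X₂ ⊆ (Finset.Ico y (ℓ + q * (k - ℓ))).image v, H.Covered ℓ 1 X₂ ∧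
      ℓ + q * (k - ℓ) ≤ y + X₂.card + k := by
    subst hd
    -- This quotient is `y / (k - ℓ)` rounded up: the index of the first edge starting at position
    -- `y` or later.
    have h1 := Nat.div_add_mod (y + (k - ℓ) - 1) (k - ℓ)
    have h2 := Nat.mod_lt (y + (k - ℓ) - 1) hd0
    rcases lt_or_ge ((y + (k - ℓ) - 1) / (k - ℓ)) q with h | h
    · have h3 := hv.isPathSet_suffix h
      refine ⟨_, Finset.image_subset_image ?_, h3.covered, ?_⟩
      · apply Finset.Ico_subset_Ico_left; rw [mul_comm]; omega
      · rw [hcard, Nat.card_Ico, mul_comm ((y + (k - ℓ) - 1) / (k - ℓ))]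
        · omega
        · intro i hi
          exact Finset.mem_range.2 (Finset.mem_Ico.1 hi).2
    · refine ⟨∅, by simp, .nil _, ?_⟩
      have : (k - ℓ) * q ≤ (k - ℓ) * ((y + (k - ℓ) - 1) / (k - ℓ)) := Nat.mul_le_mul_left _ h
      rw [mul_comm q]
      omega
  obtain ⟨X₁, hX₁, hc₁, h₁⟩ := first
  obtain ⟨X₂, hX₂, hc₂, h₂⟩ := second
  refine ⟨(Finset.range y).image v, X₁, X₂, Finset.image_subset_image hys, ?_, hX₁, ?_, hc₁, hc₂,
    by omega⟩
  · rw [hcard _ hys, Finset.card_range]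
  · refine hX₂.trans ?_
    intro z hz
    obtain ⟨i, hi, rfl⟩ := Finset.mem_image.1 hz
    rw [Finset.mem_Ico] at hi
    refine Finset.mem_sdiff.2 ⟨Finset.mem_image_of_mem _ (Finset.mem_range.2 hi.2), fun h => ?_⟩
    obtain ⟨j, hj, hij⟩ := Finset.mem_image.1 h
    rw [Finset.mem_range] at hj
    have := hv.1 (Set.mem_Iio.2 (hj.trans_le hy)) (Set.mem_Iio.2 hi.2) hij
    omega

/-- With the paths laid end to end, a single cut goes through at most one of them, so the loss `2 *
k` does not depend on `p`. -/
theorem Covered.split {H : KGraph V k} {ℓ p : ℕ} (hℓk : ℓ < k) {X : Finset V}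
    (h : H.Covered ℓ p X) {y : ℕ} (hy : y ≤ X.card) :
    ∃ Y X₁ X₂ : Finset V, Y ⊆ X ∧ Y.card = y ∧ X₁ ⊆ Y ∧ X₂ ⊆ X \ Y ∧ H.Covered ℓ p X₁ ∧
      H.Covered ℓ p X₂ ∧ X.card ≤ X₁.card + X₂.card + 2 * k := by
  induction h generalizing y with
  | nil p =>
    refine ⟨∅, ∅, ∅, by simp, ?_, by simp, by simp, .nil _, .nil _, by simp⟩
    simp at hy ⊢; omega
  | @cons p X Z hX hZ hXZ ih =>
    rw [Finset.card_union_of_disjoint hXZ] at hy ⊢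
    rcases le_total y X.card with h | h
    · obtain ⟨Y, X₁, X₂, h1, h2, h3, h4, h5, h6, h7⟩ := ih h
      have hX₂ : Disjoint X₂ Z :=
        Finset.disjoint_of_subset_left (h4.trans Finset.sdiff_subset) hXZ
      refine ⟨Y, X₁, X₂ ∪ Z, h1.trans Finset.subset_union_left, h2, h3, ?_, h5.mono (by omega),
        .cons h6 hZ hX₂, ?_⟩
      · rw [Finset.union_sdiff_distrib]
        apply Finset.union_subset_union h4
        rw [Finset.sdiff_eq_self_of_disjoint (Finset.disjoint_of_subset_left h1 hXZ).symm]
      · rw [Finset.card_union_of_disjoint hX₂]; omega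
    · obtain ⟨Y, X₁, X₂, h1, h2, h3, h4, h5, h6, h7⟩ := hZ.split hℓk
        (show y - X.card ≤ Z.card by omega)
      have hXY : Disjoint X Y := Finset.disjoint_of_subset_right h1 hXZ
      have hXX₁ : Disjoint X X₁ := Finset.disjoint_of_subset_right h3 hXY
      refine ⟨X ∪ Y, X ∪ X₁, X₂, Finset.union_subset_union subset_rfl h1, ?_,
        Finset.union_subset_union subset_rfl h3, ?_, hX.union h5 hXX₁, h6.mono (by omega), ?_⟩
      · rw [Finset.card_union_of_disjoint hXY]; omega
      · intro z hz
        have := h4 hz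
        rw [Finset.mem_sdiff] at this
        refine Finset.mem_sdiff.2 ⟨Finset.mem_union_right _ this.1, fun h => ?_⟩
        rcases Finset.mem_union.1 h with h | h
        exacts [Finset.disjoint_left.1 hXZ h this.1, this.2 h]
      · rw [Finset.card_union_of_disjoint hXX₁]; omega

/-- A partition of a vertex set into `K` parts of size at most `w`, which cuts a given disjoint
union of paths into disjoint unions of paths at the cost of at most `2 * k` vertices per part. -/
theorem Covered.exists_partition {H : KGraph V k} {ℓ p w : ℕ} (hℓk : ℓ < k) (K : ℕ)
    {S X : Finset V} (h : H.Covered ℓ p X) (hXS : X ⊆ S) (hS : S.card ≤ K * w) :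
    ∃ W Y : Fin K → Finset V, (∀ i, (W i).card ≤ w) ∧ (∀ i j, i ≠ j → Disjoint (W i) (W j)) ∧
      Finset.univ.biUnion W = S ∧ (∀ i, Y i ⊆ W i) ∧ (∀ i, Y i ⊆ X) ∧ (∀ i, H.Covered ℓ p (Y i)) ∧
      X.card ≤ ∑ i, (Y i).card + 2 * k * K := by
  induction K generalizing S X with
  | zero =>
    have : S = ∅ := by simpa using hS
    subst this
    have : X = ∅ := Finset.subset_empty.1 hXS
    subst this
    exact ⟨fun _ => ∅, fun _ => ∅, by simp, by simp, by simp, by simp, by simp,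
      fun _ => .nil _, by simp⟩
  | succ K ih =>
    obtain ⟨T, X₁, X₂, hTS, hTw, hST, h1, h2, hX₁, hX₂, h3, h4, h5⟩ : ∃ T X₁ X₂ : Finset V, T ⊆ S ∧
        T.card ≤ w ∧ (S \ T).card ≤ K * w ∧ X₁ ⊆ T ∧ X₂ ⊆ S \ T ∧ X₁ ⊆ X ∧ X₂ ⊆ X ∧ H.Covered ℓ p X₁ ∧
        H.Covered ℓ p X₂ ∧ X.card ≤ X₁.card + X₂.card + 2 * k := by
      rw [add_mul, one_mul] at hS
      -- While at least `w` covered vertices remain, the new part consists of covered vertices only;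
      -- otherwise all of `X` fits into it and uncovered vertices fill it up.
      rcases le_total w X.card with hw | hw
      · obtain ⟨T, X₁, X₂, h1, h2, h3, h4, h5, h6, h7⟩ := h.split hℓk hw
        refine ⟨T, X₁, X₂, h1.trans hXS, h2.le, ?_, h3,
          h4.trans (Finset.sdiff_subset_sdiff hXS subset_rfl), h3.trans h1,
          h4.trans Finset.sdiff_subset, h5, h6, h7⟩
        rw [Finset.card_sdiff_of_subset (h1.trans hXS)]; omega
      · rcases le_total w S.card with hw' | hw'
        · obtain ⟨T, h1, h2, h3⟩ := Finset.exists_subsuperset_card_eq hXS hw hw'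
          refine ⟨T, X, ∅, h2, h3.le, ?_, h1, by simp, subset_rfl, by simp, h, .nil _, by simp⟩
          rw [Finset.card_sdiff_of_subset h2]; omega
        · exact ⟨S, X, ∅, subset_rfl, hw', by simp, hXS, by simp, subset_rfl, by simp, h, .nil _,
            by simp⟩
    obtain ⟨W, Y, g1, g2, g3, g4, gX, g5, g6⟩ := ih h4 h2 hST
    have hW : ∀ i, Disjoint T (W i) := fun i => by
      refine Finset.disjoint_of_subset_right ?_ Finset.disjoint_sdiff (s := T) (u := S \ T)
      rw [← g3]; exact Finset.subset_biUnion_of_mem W (Finset.mem_univ i)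
    refine ⟨Fin.cons T W, Fin.cons X₁ Y, ?_, ?_, ?_, ?_, ?_, ?_, ?_⟩
    · exact Fin.cases hTw g1
    · refine Fin.cases (Fin.cases (by simp) fun j _ => hW j) fun i => Fin.cases
        (fun _ => (hW i).symm) fun j hij => g2 i j fun h => hij (h ▸ rfl)
    · ext z
      simp only [Finset.mem_biUnion, Finset.mem_univ, true_and, Fin.exists_fin_succ, Fin.cons_zero,
        Fin.cons_succ]
      have := Finset.ext_iff.1 g3 z
      simp only [Finset.mem_biUnion, Finset.mem_univ, true_and, Finset.mem_sdiff] at this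
      rw [this]
      have := @hTS z
      tauto
    · exact Fin.cases h1 g4
    · exact Fin.cases hX₁ fun i => (gX i).trans hX₂
    · exact Fin.cases h3 g5
    · rw [Fin.sum_univ_succ]
      simp only [Fin.cons_zero, Fin.cons_succ]
      rw [mul_add]; omega

/-- Appending a set `N` of new vertices with `J ∪ N` an edge to a path ending in the joint `J`. -/
theorem IsPathSeq.extend {H : KGraph V k} {ℓ q : ℕ} {v : ℕ → V} (hℓk : 2 * ℓ ≤ k)
    (hv : H.IsPathSeq ℓ q v) {N J' : Finset V} (hN : N.card = k - ℓ) (hJ' : J'.card = ℓ)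
    (hJN : J' ⊆ N) (hNv : N ⊆ H.verts)
    (hdis : Disjoint ((Finset.range (ℓ + q * (k - ℓ))).image v) N)
    (he : (Finset.Ico (q * (k - ℓ)) (q * (k - ℓ) + ℓ)).image v ∪ N ∈ H.edges) :
    ∃ v', H.IsPathSeq ℓ (q + 1) v' ∧
      (Finset.range (ℓ + (q + 1) * (k - ℓ))).image v' =
        (Finset.range (ℓ + q * (k - ℓ))).image v ∪ N ∧
      (Finset.Ico ((q + 1) * (k - ℓ)) ((q + 1) * (k - ℓ) + ℓ)).image v' = J' := by
  -- The new vertices are listed with `J'` at the end, so that `J'` becomes the next joint. The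
  -- value `v 0` below is never used.
  obtain ⟨u, hu, huJ⟩ : ∃ u : ℕ → V, (Finset.range (k - ℓ)).image u = N ∧
      (Finset.Ico (k - 2 * ℓ) (k - ℓ)).image u = J' := by
    have e₁ := ((N \ J').equivFinOfCardEq (n := k - 2 * ℓ)
      (by rw [Finset.card_sdiff_of_subset hJN]; omega)).symm
    have e₂ := (J'.equivFinOfCardEq hJ').symm
    have im₂ : ∀ z, z ∈ J' ↔ ∃ i, (e₂ i : V) = z := fun z =>
      ⟨fun h => ⟨e₂.symm ⟨z, h⟩, by simp⟩, fun ⟨i, h⟩ => h ▸ (e₂ i).2⟩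
    have im₁ : ∀ z, z ∈ N \ J' ↔ ∃ i, (e₁ i : V) = z := fun z =>
      ⟨fun h => ⟨e₁.symm ⟨z, h⟩, by simp⟩, fun ⟨i, h⟩ => h ▸ (e₁ i).2⟩
    let u : ℕ → V := fun i => if h : i < k - 2 * ℓ then e₁ ⟨i, h⟩ else
      if h' : i - (k - 2 * ℓ) < ℓ then e₂ ⟨i - (k - 2 * ℓ), h'⟩ else v 0
    have hu₂ : (Finset.Ico (k - 2 * ℓ) (k - ℓ)).image u = J' := by
      ext z
      rw [im₂, Finset.mem_image]
      constructor
      · rintro ⟨i, hi, rfl⟩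
        rw [Finset.mem_Ico] at hi
        exact ⟨⟨i - (k - 2 * ℓ), by omega⟩, by
          simp only [u]; rw [dif_neg (by omega), dif_pos (by omega)]⟩
      · rintro ⟨i, rfl⟩
        refine ⟨i + (k - 2 * ℓ), Finset.mem_Ico.2 (by omega), ?_⟩
        simp only [u]
        rw [dif_neg (by omega), dif_pos (by omega)]
        congr 2
        ext; simp
    refine ⟨u, ?_, hu₂⟩
    have hu₁ : (Finset.range (k - 2 * ℓ)).image u = N \ J' := by
      ext z
      rw [im₁, Finset.mem_image]
      constructor
      · rintro ⟨i, hi, rfl⟩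
        rw [Finset.mem_range] at hi
        exact ⟨⟨i, hi⟩, by simp only [u]; rw [dif_pos hi]⟩
      · rintro ⟨i, rfl⟩
        exact ⟨i, Finset.mem_range.2 i.2, by simp only [u]; rw [dif_pos i.2]⟩
    rw [Finset.range_eq_Ico, ← Finset.Ico_union_Ico_eq_Ico (Nat.zero_le _)
      (show k - 2 * ℓ ≤ k - ℓ by omega), Finset.image_union, hu₂, ← Finset.range_eq_Ico, hu₁,
      Finset.sdiff_union_of_subset hJN]
  have huinj : Set.InjOn u (Finset.range (k - ℓ)) := by
    apply Finset.injOn_of_card_image_eq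
    rw [hu, hN, Finset.card_range]
  obtain ⟨T, hT⟩ : ∃ T, T = ℓ + q * (k - ℓ) := ⟨_, rfl⟩
  have hT' : ℓ + (q + 1) * (k - ℓ) = T + (k - ℓ) := by rw [hT]; ring
  have hq' : (q + 1) * (k - ℓ) = T + (k - 2 * ℓ) := by rw [add_mul, one_mul]; omega
  let v' : ℕ → V := fun i => if i < T then v i else u (i - T)
  have old : ∀ s : Finset ℕ, (∀ i ∈ s, i < T) → s.image v' = s.image v := fun s hs =>
    Finset.image_congr fun i hi => if_pos (hs i hi)
  have new : ∀ a b : ℕ, (Finset.Ico (T + a) (T + b)).image v' = (Finset.Ico a b).image u := by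
    intro a b
    rw [add_comm T, add_comm T, ← Finset.image_add_right_Ico, Finset.image_image]
    apply Finset.image_congr
    intro i _
    simp [v']
  have newT : ∀ b : ℕ, (Finset.Ico T (T + b)).image v' = (Finset.range b).image u := by
    intro b; have := new 0 b; rwa [add_zero, ← Finset.range_eq_Ico] at this
  have hunion : (Finset.range (T + (k - ℓ))).image v' = (Finset.range T).image v ∪ N := by
    rw [Finset.range_eq_Ico, ← Finset.Ico_union_Ico_eq_Ico (Nat.zero_le T) (Nat.le_add_right _ _),
      Finset.image_union, newT, hu, ← Finset.range_eq_Ico,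
      old _ fun i hi => Finset.mem_range.1 hi]
  refine ⟨v', ⟨?_, ?_, ?_⟩, ?_, ?_⟩
  · rw [hT']
    have := Finset.injOn_of_card_image_eq (s := Finset.range (T + (k - ℓ))) (f := v') (by
      rw [hunion, Finset.card_union_of_disjoint (hT ▸ hdis), hN, Finset.card_range,
        Finset.card_image_of_injOn, Finset.card_range]
      rw [hT]
      simpa using hv.1)
    simpa using this
  · intro i hi
    have : v' i ∈ (Finset.range (T + (k - ℓ))).image v' :=
      Finset.mem_image_of_mem _ (Finset.mem_range.2 (hT' ▸ hi))
    rw [hunion] at this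
    rcases Finset.mem_union.1 this with h | h
    · obtain ⟨j, hj, hij⟩ := Finset.mem_image.1 h
      rw [← hij]; exact hv.2.1 j (hT ▸ Finset.mem_range.1 hj)
    · exact hNv h
  · intro i hi
    rcases Nat.lt_succ_iff_lt_or_eq.1 hi with h | rfl
    · rw [old]
      · exact hv.2.2 i h
      · intro j hj
        rw [hT]; exact block_lt (by omega) h (Finset.mem_Ico.1 hj).2
    · rw [← Finset.Ico_union_Ico_eq_Ico (show i * (k - ℓ) ≤ T by omega)
        (show T ≤ i * (k - ℓ) + k by omega), Finset.image_union,
        old _ fun j hj => (Finset.mem_Ico.1 hj).2,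
        show i * (k - ℓ) + k = T + (k - ℓ) by omega, newT, hu]
      convert he using 3
      rw [hT]; ring_nf
  · rw [hT', hunion, hT]
  · rw [hq', show T + (k - 2 * ℓ) + ℓ = T + (k - ℓ) by omega, new, huJ]

end Paths

/-! ### Ordered edges, robust subfamilies and long paths -/

section Tuples

variable {V : Type*} [DecidableEq V]

theorem card_filter_exists_mem_le {ι : Type*} [Fintype ι] [DecidableEq ι] (S : ι → Finset V)
    (T : Finset ι) (Y : Finset V) :
    ((Fintype.piFinset S).filter fun f => ∃ j ∈ T, f j ∈ Y).card ≤
      ∑ j ∈ T, Y.card * ∏ i ∈ Finset.univ \ {j}, (S i).card := by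
  have hsub : ((Fintype.piFinset S).filter fun f => ∃ j ∈ T, f j ∈ Y) ⊆
      T.biUnion fun j => Fintype.piFinset (Function.update S j Y) := by
    intro f hf
    obtain ⟨hf, j, hj, hjY⟩ := Finset.mem_filter.1 hf
    rw [Fintype.mem_piFinset] at hf
    refine Finset.mem_biUnion.2 ⟨j, hj, Fintype.mem_piFinset.2 fun i => ?_⟩
    rcases eq_or_ne i j with rfl | h
    · simpa using hjY
    · simpa [h] using hf i
  refine (Finset.card_le_card hsub).trans (Finset.card_biUnion_le.trans ?_)
  refine Finset.sum_le_sum fun j _ => le_of_eq ?_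
  rw [Fintype.card_piFinset]
  simp only [Function.apply_update (fun _ (s : Finset V) => s.card)]
  exact Finset.prod_update_of_mem (Finset.mem_univ j) _ _

theorem card_filter_hit_le {ι : Type*} [Fintype ι] [DecidableEq ι] (S : ι → Finset V) {w : ℕ}
    (hS : ∀ i, (S i).card ≤ w) (Y : Finset V) :
    ((Fintype.piFinset S).filter fun f => ∃ j, f j ∈ Y).card ≤
      Fintype.card ι * (Y.card * w ^ (Fintype.card ι - 1)) := by
  have h := card_filter_exists_mem_le S Finset.univ Y
  simp only [Finset.mem_univ, true_and] at h
  refine h.trans ((Finset.sum_le_card_nsmul _ _ (Y.card * w ^ (Fintype.card ι - 1)) ?_).trans_eq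
    (by simp))
  intro j _
  refine Nat.mul_le_mul_left _ ((Finset.prod_le_pow_card _ _ _ fun i _ => hS i).trans_eq ?_)
  rw [Finset.card_sdiff_of_subset (Finset.subset_univ _)]
  simp

theorem card_filter_fixed_hit_le {ι : Type*} [Fintype ι] [DecidableEq ι] (S : Finset V)
    (D : Finset ι) (x : ι → V) (Y : Finset V) :
    ((Fintype.piFinset fun _ : ι => S).filter
      fun f => (∀ i ∈ D, f i = x i) ∧ ∃ j, j ∉ D ∧ f j ∈ Y).card ≤
      Fintype.card ι * (Y.card * S.card ^ (Fintype.card ι - D.card - 1)) := by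
  have h := card_filter_exists_mem_le (fun i => if i ∈ D then {x i} else S) Dᶜ Y
  refine (Finset.card_le_card ?_).trans (h.trans ((Finset.sum_le_card_nsmul _ _
    (Y.card * S.card ^ (Fintype.card ι - D.card - 1)) ?_).trans ?_))
  · intro f hf
    simp only [Finset.mem_filter, Fintype.mem_piFinset, Finset.mem_compl] at hf ⊢
    refine ⟨fun i => ?_, hf.2.2⟩
    split_ifs with hi
    · simpa using hf.2.1 i hi
    · exact hf.1 i
  · intro j hj
    refine Nat.mul_le_mul_left _ (le_of_eq ?_)
    rw [← Finset.prod_sdiff (s₁ := D) (s₂ := Finset.univ \ {j})]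
    · rw [Finset.prod_congr rfl (g := fun _ => S.card), Finset.prod_const,
        Finset.prod_eq_one, mul_one]
      · congr 1
        rw [Finset.card_sdiff_of_subset, Finset.card_sdiff_of_subset (Finset.subset_univ _)]
        · simp; omega
        · intro i hi
          simp only [Finset.mem_sdiff, Finset.mem_univ, true_and, Finset.mem_singleton]
          rintro rfl
          exact Finset.mem_compl.1 hj hi
      · intro i hi; simp [hi]
      · intro i hi; simp [(Finset.mem_sdiff.1 hi).2]
    · intro i hi
      simp only [Finset.mem_sdiff, Finset.mem_univ, true_and, Finset.mem_singleton]
      rintro rfl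
      exact Finset.mem_compl.1 hj hi
  · rw [smul_eq_mul]
    exact Nat.mul_le_mul_right _ (Finset.card_le_univ _)

/-- A large set has a nonempty subset in which all fibres of two given maps are large. -/
theorem exists_robust_subset.{u, v} {α : Type u} {β β' : Type v} [DecidableEq α] [DecidableEq β] [DecidableEq β']
    (R : Finset α) (φ : α → β) (ψ : α → β') {δ : ℝ} {N : ℕ} (hδ : 0 ≤ δ)
    (hφ : (R.image φ).card ≤ N) (hψ : (R.image ψ).card ≤ N) (h : 2 * δ * N < R.card) :
    ∃ R' ⊆ R, R'.Nonempty ∧ (∀ f ∈ R', δ ≤ ((R'.filter fun g => φ g = φ f).card : ℝ)) ∧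
      ∀ f ∈ R', δ ≤ ((R'.filter fun g => ψ g = ψ f).card : ℝ) := by
  -- A maximiser of `Φ` works: deleting a whole fibre of `φ` or `ψ` saves at least `δ`, so the fibre
  -- must have at least `δ` elements. It is nonempty because `Φ R > 0 = Φ ∅`.
  let Φ : Finset α → ℝ := fun Q =>
    (Q.card : ℝ) - δ * (((Q.image φ).card : ℝ) + ((Q.image ψ).card : ℝ))
  obtain ⟨Q, hQ, hmax⟩ := R.powerset.exists_max_image Φ ⟨R, by simp⟩
  rw [Finset.mem_powerset] at hQ
  have key : ∀ P ⊆ Q, ∀ a b : ℕ, (P.image φ).card + a ≤ (Q.image φ).card →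
      (P.image ψ).card + b ≤ (Q.image ψ).card → δ * (a + b) ≤ ((Q \ P).card : ℝ) := by
    intro P hP a b ha hb
    have h1 := hmax P (Finset.mem_powerset.2 (hP.trans hQ))
    have h2 : ((Q \ P).card : ℝ) = Q.card - P.card := by
      rw [Finset.card_sdiff_of_subset hP, Nat.cast_sub (Finset.card_le_card hP)]
    have ha' : ((P.image φ).card : ℝ) + a ≤ ((Q.image φ).card : ℝ) := by exact_mod_cast ha
    have hb' : ((P.image ψ).card : ℝ) + b ≤ ((Q.image ψ).card : ℝ) := by exact_mod_cast hb
    simp only [Φ] at h1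
    have h3 := mul_le_mul_of_nonneg_left (add_le_add ha' hb') hδ
    rw [h2]
    nlinarith
  have rest : ∀ {γ : Type v} [DecidableEq γ] (χ : α → γ) (f), f ∈ Q →
      Q \ (Q.filter fun g => χ g ≠ χ f) = Q.filter (fun g => χ g = χ f) ∧
      ((Q.filter fun g => χ g ≠ χ f).image χ).card + 1 ≤ (Q.image χ).card := by
    intro γ _ χ f hf
    constructor
    · ext g; simp only [Finset.mem_sdiff, Finset.mem_filter]; tauto
    · refine Nat.succ_le_of_lt (Finset.card_lt_card (Finset.ssubset_iff_of_subset
        (Finset.image_subset_image (Finset.filter_subset _ _)) |>.2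
        ⟨χ f, Finset.mem_image_of_mem _ hf, ?_⟩))
      simp
  refine ⟨Q, hQ, ?_, fun f hf => ?_, fun f hf => ?_⟩
  · rw [Finset.nonempty_iff_ne_empty]
    rintro rfl
    have h1 := hmax R (by simp)
    have hφ' : ((R.image φ).card : ℝ) ≤ N := by exact_mod_cast hφ
    have hψ' : ((R.image ψ).card : ℝ) ≤ N := by exact_mod_cast hψ
    simp only [Φ, Finset.card_empty, Finset.image_empty] at h1
    have h3 := mul_le_mul_of_nonneg_left (add_le_add hφ' hψ') hδ
    norm_num at h1
    nlinarith
  · have := key _ (Finset.filter_subset (fun g => φ g ≠ φ f) Q) 1 0 (rest φ f hf).2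
      (Finset.card_le_card (Finset.image_subset_image (Finset.filter_subset _ _)))
    rw [(rest φ f hf).1] at this
    simpa using this
  · have := key _ (Finset.filter_subset (fun g => ψ g ≠ ψ f) Q) 0 1
      (Finset.card_le_card (Finset.image_subset_image (Finset.filter_subset _ _))) (rest ψ f hf).2
    rw [(rest ψ f hf).1] at this
    simpa using this

variable {k : ℕ}

/-- The orderings of the edges of `H`. -/
def tuples (H : KGraph V k) : Finset (Fin k → V) :=
  (Fintype.piFinset fun _ => H.verts).filter
    fun f => Function.Injective f ∧ Finset.univ.image f ∈ H.edges

theorem mem_tuples {H : KGraph V k} {f : Fin k → V} :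
    f ∈ H.tuples ↔ Function.Injective f ∧ Finset.univ.image f ∈ H.edges := by
  simp only [tuples, Finset.mem_filter, Fintype.mem_piFinset, and_iff_right_iff_imp]
  intro h i
  exact H.edge_subset _ h.2 (Finset.mem_image_of_mem f (Finset.mem_univ i))

theorem mem_verts_of_mem_tuples {H : KGraph V k} {f : Fin k → V} (hf : f ∈ H.tuples)
    (i : Fin k) : f i ∈ H.verts :=
  H.edge_subset _ (mem_tuples.1 hf).2 (Finset.mem_image_of_mem f (Finset.mem_univ i))

theorem card_image_restrict_le {H : KGraph V k} {R : Finset (Fin k → V)} (hR : R ⊆ H.tuples)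
    (D : Finset (Fin k)) :
    (R.image fun f (i : D) => f i).card ≤ H.verts.card ^ D.card := by
  refine (Finset.card_le_card (t := Fintype.piFinset fun _ : D => H.verts) ?_).trans_eq (by simp)
  intro g hg
  obtain ⟨f, hf, rfl⟩ := Finset.mem_image.1 hg
  exact Fintype.mem_piFinset.2 fun i => mem_verts_of_mem_tuples (hR hf) _

/-- There are at least `δ` tuples in `R` agreeing with `f` on `D`, and by a union bound too few of
them meet `Y` outside `D` to exhaust these. -/
theorem exists_tuple_avoiding {H : KGraph V k} {R : Finset (Fin k → V)} (hR : R ⊆ H.tuples)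
    (D : Finset (Fin k)) {δ : ℝ} {f : Fin k → V}
    (hf : δ ≤ ((R.filter fun g => (fun (i : D) => g i) = fun (i : D) => f i).card : ℝ))
    {Y : Finset V} (hY : (k * (Y.card * H.verts.card ^ (k - D.card - 1)) : ℝ) < δ) :
    ∃ g ∈ R, (∀ i ∈ D, g i = f i) ∧ ∀ i ∉ D, g i ∉ Y := by
  by_contra! hcon
  have h1 := card_filter_fixed_hit_le H.verts D f Y
  rw [Fintype.card_fin] at h1
  have h2 : (R.filter fun g => (fun (i : D) => g i) = fun (i : D) => f i).card ≤
      k * (Y.card * H.verts.card ^ (k - D.card - 1)) := by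
    refine (Finset.card_le_card ?_).trans h1
    intro g hg
    obtain ⟨hg, hgf⟩ := Finset.mem_filter.1 hg
    have hgf' : ∀ i ∈ D, g i = f i := fun i hi => congrFun hgf ⟨i, hi⟩
    exact (@Finset.mem_filter _ _ (_) _ _).2
      ⟨Fintype.mem_piFinset.2 fun i => mem_verts_of_mem_tuples (hR hg) i, hgf', hcon g hg hgf'⟩
  have h3 : ((R.filter fun g => (fun (i : D) => g i) = fun (i : D) => f i).card : ℝ) ≤
      k * (Y.card * H.verts.card ^ (k - D.card - 1)) := by exact_mod_cast h2
  linarith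

theorem IsPathSeq.extend_tuple {H : KGraph V k} {ℓ q : ℕ} {v : ℕ → V} (hℓk : 2 * ℓ ≤ k)
    (hv : H.IsPathSeq ℓ q v) {D D' : Finset (Fin k)} (hD : D.card = ℓ) (hD' : D'.card = ℓ)
    (hDD : Disjoint D D') {f g : Fin k → V} (hg : g ∈ H.tuples)
    (hJ : (Finset.Ico (q * (k - ℓ)) (q * (k - ℓ) + ℓ)).image v = D.image f)
    (hgf : ∀ i ∈ D, g i = f i)
    (hgY : ∀ i ∉ D, g i ∉ (Finset.range (ℓ + q * (k - ℓ))).image v) :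
    ∃ v', H.IsPathSeq ℓ (q + 1) v' ∧
      (Finset.range (ℓ + (q + 1) * (k - ℓ))).image v' =
        (Finset.range (ℓ + q * (k - ℓ))).image v ∪ Dᶜ.image g ∧
      (Finset.Ico ((q + 1) * (k - ℓ)) ((q + 1) * (k - ℓ) + ℓ)).image v' = D'.image g := by
  obtain ⟨hinj, he⟩ := mem_tuples.1 hg
  refine hv.extend hℓk ?_ ?_ ?_ ?_ ?_ ?_
  · rw [Finset.card_image_of_injective _ hinj, Finset.card_compl, hD, Fintype.card_fin]
  · rw [Finset.card_image_of_injective _ hinj, hD']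
  · exact Finset.image_subset_image (Finset.subset_compl_comm.1
      (Finset.subset_compl_iff_disjoint_right.2 hDD))
  · intro z hz
    obtain ⟨i, -, rfl⟩ := Finset.mem_image.1 hz
    exact mem_verts_of_mem_tuples hg i
  · rw [Finset.disjoint_right]
    intro z hz
    obtain ⟨i, hi, rfl⟩ := Finset.mem_image.1 hz
    exact hgY i (Finset.mem_compl.1 hi)
  · rw [hJ, Finset.image_congr (s := D) (f := f) (g := g) fun i hi => (hgf i hi).symm,
      ← Finset.image_union, Finset.union_compl]
    exact he

/-- A dense set `R` of ordered edges of `H` contains a long path. If membership in `A` singles out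
the `j₀`-th vertex of every tuple in `R`, then the path meets `A` in every second joint. -/
theorem exists_long_path {ℓ : ℕ} (hℓ : 1 ≤ ℓ) (hℓk : 2 * ℓ < k) (H : KGraph V k)
    {R : Finset (Fin k → V)} (hR : R ⊆ H.tuples) {ε : ℝ} (hε : 0 < ε)
    (hRε : ε * (H.verts.card : ℝ) ^ k ≤ R.card) (j₀ : Fin k) {r : ℕ} (hr : 1 ≤ r)
    (hrn : 8 * (k : ℝ) ^ 2 * (r + 1) < ε * H.verts.card) :
    ∃ Z, H.IsPathSet ℓ Z ∧ Z.card = ℓ + r * (2 * (k - ℓ)) ∧ (∀ z ∈ Z, ∃ f ∈ R, ∃ i, f i = z) ∧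
      ∀ A : Finset V, (∀ f ∈ R, ∀ i, f i ∈ A ↔ i = j₀) → (Z ∩ A).card = r := by
  obtain ⟨n, hn⟩ : ∃ n, n = H.verts.card := ⟨_, rfl⟩
  rw [← hn] at hRε hrn
  have hn0 : (0 : ℝ) < n := by
    have : 0 < ε * (n : ℝ) := lt_of_le_of_lt (by positivity) hrn
    exact pos_of_mul_pos_right this hε.le
  -- The joints alternate between the coordinate sets `D₁` and `D₂`. Placing `j₀` in `D₂` makes
  -- consecutive edges share their `A`-vertex, hence one such vertex per two edges.
  obtain ⟨D₂, hjD, -, hD₂⟩ := Finset.exists_subsuperset_card_eq (s := {j₀})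
    (t := (Finset.univ : Finset (Fin k))) (n := ℓ) (Finset.subset_univ _) (by simpa using hℓ)
    (by simp; omega)
  obtain ⟨D₁, hDD, hD₁⟩ := Finset.exists_subset_card_eq (s := D₂ᶜ) (n := ℓ)
    (by rw [Finset.card_compl, hD₂, Fintype.card_fin]; omega)
  rw [Finset.singleton_subset_iff] at hjD
  have hDD : Disjoint D₁ D₂ := Finset.subset_compl_iff_disjoint_right.1 hDD
  -- Each restriction map has at most `n ^ ℓ` values, and `2 * δ * n ^ ℓ` is half of `ε * n ^ k`.
  obtain ⟨δ, hδ⟩ : ∃ δ : ℝ, δ = ε / 4 * (n : ℝ) ^ (k - ℓ) := ⟨_, rfl⟩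
  have hδ0 : 0 < δ := by rw [hδ]; positivity
  obtain ⟨R', hR'R, ⟨f₀, hf₀⟩, hdeg₁, hdeg₂⟩ := exists_robust_subset R
    (fun f (i : D₁) => f i) (fun f (i : D₂) => f i) (N := n ^ ℓ) hδ0.le
    (by rw [hn, ← hD₁]; exact card_image_restrict_le hR D₁)
    (by rw [hn, ← hD₂]; exact card_image_restrict_le hR D₂) (by
      refine lt_of_lt_of_le ?_ hRε
      have : (n : ℝ) ^ k = (n : ℝ) ^ (k - ℓ) * (n : ℝ) ^ ℓ := by
        rw [← pow_add]; congr 1; omega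
      rw [hδ, this]
      push_cast
      have : 0 < (n : ℝ) ^ (k - ℓ) * (n : ℝ) ^ ℓ := by positivity
      nlinarith)
  have small : ∀ Y : Finset V, Y.card ≤ 2 * k * r →
      (k * (Y.card * H.verts.card ^ (k - ℓ - 1)) : ℝ) < δ := by
    intro Y hY
    have hY' : (Y.card : ℝ) ≤ 2 * k * r := by exact_mod_cast hY
    have hpow : (n : ℝ) ^ (k - ℓ) = (n : ℝ) ^ (k - ℓ - 1) * n := by
      rw [← pow_succ]; congr 1; omega
    rw [hδ, ← hn, hpow]
    have h0 : (0 : ℝ) < (n : ℝ) ^ (k - ℓ - 1) := by positivity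
    have h1 : (k : ℝ) * Y.card < ε / 4 * n := by
      have := mul_le_mul_of_nonneg_left hY' (Nat.cast_nonneg (α := ℝ) k)
      nlinarith [sq_nonneg (k : ℝ)]
    nlinarith
  have hR't : R' ⊆ H.tuples := hR'R.trans hR
  have main : ∀ s ≤ r, ∃ v, ∃ f ∈ R', H.IsPathSeq ℓ (2 * s) v ∧
      (Finset.Ico (2 * s * (k - ℓ)) (2 * s * (k - ℓ) + ℓ)).image v = D₁.image f ∧
      (∀ z ∈ (Finset.range (ℓ + 2 * s * (k - ℓ))).image v, ∃ f ∈ R, ∃ i, f i = z) ∧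
      ∀ A : Finset V, (∀ f ∈ R, ∀ i, f i ∈ A ↔ i = j₀) →
        ((Finset.range (ℓ + 2 * s * (k - ℓ))).image v ∩ A).card = s := by
    intro s
    induction s with
    | zero =>
      intro _
      obtain ⟨e⟩ : Nonempty (Fin ℓ ≃ D₁) := ⟨(D₁.equivFinOfCardEq hD₁).symm⟩
      obtain ⟨v, hv⟩ : ∃ v : ℕ → V, v = fun i => if h : i < ℓ then f₀ (e ⟨i, h⟩) else f₀ j₀ :=
        ⟨_, rfl⟩
      have him : (Finset.range ℓ).image v = D₁.image f₀ := by
        ext z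
        simp only [Finset.mem_image, Finset.mem_range, hv]
        constructor
        · rintro ⟨i, hi, rfl⟩
          exact ⟨e ⟨i, hi⟩, (e ⟨i, hi⟩).2, by rw [dif_pos hi]⟩
        · rintro ⟨i, hi, rfl⟩
          refine ⟨e.symm ⟨i, hi⟩, (e.symm ⟨i, hi⟩).2, ?_⟩
          rw [dif_pos (e.symm ⟨i, hi⟩).2]
          simp
      have hmem : ∀ z ∈ (Finset.range ℓ).image v, ∃ f ∈ R, ∃ i ∈ D₁, f i = z := by
        intro z hz
        rw [him] at hz
        obtain ⟨i, hi, rfl⟩ := Finset.mem_image.1 hz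
        exact ⟨f₀, hR'R hf₀, i, hi, rfl⟩
      refine ⟨v, f₀, hf₀, ⟨?_, ?_, by simp⟩, by simpa [← Finset.range_eq_Ico] using him, ?_, ?_⟩
      · have := Finset.injOn_of_card_image_eq (s := Finset.range ℓ) (f := v) (by
          rw [him, Finset.card_image_of_injective _ (mem_tuples.1 (hR't hf₀)).1, hD₁,
            Finset.card_range])
        simpa using this
      · intro i hi
        obtain ⟨f, hf, j, -, hj⟩ := hmem _ (Finset.mem_image_of_mem v
          (Finset.mem_range.2 (by simpa using hi)))
        rw [← hj]; exact mem_verts_of_mem_tuples (hR hf) j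
      · intro z hz
        obtain ⟨f, hf, j, -, hj⟩ := hmem z (by simpa using hz)
        exact ⟨f, hf, j, hj⟩
      · intro A hA
        rw [Finset.card_eq_zero, ← Finset.disjoint_iff_inter_eq_empty, Finset.disjoint_left]
        intro z hz hzA
        obtain ⟨f, hf, j, hjD₁, rfl⟩ := hmem z (by simpa using hz)
        rw [(hA f hf j).1 hzA] at hjD₁
        exact Finset.disjoint_left.1 hDD hjD₁ hjD
    | succ s ih =>
      intro hs
      obtain ⟨v, f, hf, hv, hJ, hmem, hA⟩ := ih (by omega)
      have hcard : ∀ q, q < 2 * r → ∀ v : ℕ → V,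
          ((Finset.range (ℓ + q * (k - ℓ))).image v).card ≤ 2 * k * r := by
        intro q hq v
        refine Finset.card_image_le.trans ?_
        rw [Finset.card_range]
        calc ℓ + q * (k - ℓ) ≤ k + q * k := by gcongr <;> omega
          _ = (q + 1) * k := by ring
          _ ≤ 2 * r * k := Nat.mul_le_mul_right _ hq
          _ = 2 * k * r := by ring
      -- The edge `g` continues `f` through the joint `D₁`, and `h` continues `g` through `D₂`. Only
      -- `g` brings a new vertex of `A`; that of `h` is `g j₀`.
      obtain ⟨g, hg, hgf, hgY⟩ := exists_tuple_avoiding hR't D₁ (hdeg₁ f hf)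
        (by rw [hD₁]; exact small _ (hcard (2 * s) (by omega) v))
      obtain ⟨v₁, hv₁, hZ₁, hJ₁⟩ := hv.extend_tuple hℓk.le hD₁ hD₂ hDD (hR't hg) hJ hgf hgY
      obtain ⟨h, hh, hhf, hhY⟩ := exists_tuple_avoiding hR't D₂ (hdeg₂ g hg)
        (by rw [hD₂]; exact small _ (hcard (2 * s + 1) (by omega) v₁))
      obtain ⟨v₂, hv₂, hZ₂, hJ₂⟩ := hv₁.extend_tuple hℓk.le hD₂ hD₁ hDD.symm (hR't hh) hJ₁ hhf hhY
      refine ⟨v₂, h, hh, hv₂, hJ₂, ?_, ?_⟩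
      · rw [show 2 * (s + 1) = 2 * s + 1 + 1 by ring, hZ₂, hZ₁]
        intro z hz
        rcases Finset.mem_union.1 hz with hz | hz
        · rcases Finset.mem_union.1 hz with hz | hz
          · exact hmem z hz
          · obtain ⟨i, -, rfl⟩ := Finset.mem_image.1 hz
            exact ⟨g, hR'R hg, i, rfl⟩
        · obtain ⟨i, -, rfl⟩ := Finset.mem_image.1 hz
          exact ⟨h, hR'R hh, i, rfl⟩
      · intro A hAR
        rw [show 2 * (s + 1) = 2 * s + 1 + 1 by ring, hZ₂, hZ₁]
        have hgA : D₁ᶜ.image g ∩ A = {g j₀} := by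
          ext z
          simp only [Finset.mem_inter, Finset.mem_image, Finset.mem_singleton]
          constructor
          · rintro ⟨⟨i, -, rfl⟩, hi⟩
            rw [(hAR g (hR'R hg) i).1 hi]
          · rintro rfl
            exact ⟨⟨j₀, Finset.mem_compl.2 fun h' => Finset.disjoint_left.1 hDD h' hjD, rfl⟩,
              (hAR g (hR'R hg) j₀).2 rfl⟩
        have hhA : D₂ᶜ.image h ∩ A = ∅ := by
          rw [← Finset.disjoint_iff_inter_eq_empty, Finset.disjoint_left]
          intro z hz hzA
          obtain ⟨i, hi, rfl⟩ := Finset.mem_image.1 hz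
          rw [(hAR h (hR'R hh) i).1 hzA] at hi
          exact Finset.mem_compl.1 hi hjD
        rw [Finset.union_inter_distrib_right, Finset.union_inter_distrib_right, hgA, hhA,
          Finset.union_empty, Finset.card_union_of_disjoint, hA A hAR, Finset.card_singleton]
        rw [Finset.disjoint_singleton_right]
        exact fun h' => hgY j₀ (fun h' => Finset.disjoint_left.1 hDD h' hjD)
          (Finset.mem_inter.1 h').1
  obtain ⟨v, f, -, hv, -, hmem, hA⟩ := main r le_rfl
  refine ⟨_, ⟨2 * r, v, by omega, hv, rfl⟩, ?_, hmem, hA⟩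
  rw [Finset.card_image_of_injOn, Finset.card_range]
  · ring
  · simpa using hv.1

end Tuples

/-! ### Greedy covers by boundedly many paths -/

section Covers

variable {V : Type*} [DecidableEq V] {k : ℕ}

/-- Greedy choice: every added path covers at least `c` new vertices, so with `j * c` above the
number of vertices the process must reach `Done` within `j` paths. -/
theorem Covered.exists_of_extend {H : KGraph V k} {ℓ j : ℕ} {c : ℝ} (P Done : Finset V → Prop)
    (h0 : P ∅) (hstep : ∀ X, P X → ¬ Done X →
      ∃ Z, H.IsPathSet ℓ Z ∧ Disjoint X Z ∧ P (X ∪ Z) ∧ c ≤ (Z.card : ℝ))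
    (hj : (H.verts.card : ℝ) < j * c) : ∃ X, H.Covered ℓ j X ∧ P X ∧ Done X := by
  have main : ∀ i : ℕ, ∃ X, H.Covered ℓ i X ∧ P X ∧ (Done X ∨ i * c ≤ X.card) := by
    intro i
    induction i with
    | zero => exact ⟨∅, .nil _, h0, Or.inr (by simp)⟩
    | succ i ih =>
      obtain ⟨X, hX, hP, hd⟩ := ih
      by_cases hD : Done X
      · exact ⟨X, hX.mono (Nat.le_succ i), hP, Or.inl hD⟩
      · obtain ⟨Z, hZ, hXZ, hPZ, hc⟩ := hstep X hP hD
        refine ⟨X ∪ Z, hX.cons hZ hXZ, hPZ, Or.inr ?_⟩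
        rw [Finset.card_union_of_disjoint hXZ]
        push_cast
        linarith [hd.resolve_left hD]
  obtain ⟨X, hX, hP, hd⟩ := main j
  refine ⟨X, hX, hP, hd.resolve_right fun h => ?_⟩
  have : (X.card : ℝ) ≤ H.verts.card := by exact_mod_cast Finset.card_le_card hX.subset_verts
  linarith

/-- Takes `r` as large as `exists_long_path` comfortably allows, so that one path covers a constant
fraction of the vertices and the greedy process stops after a bounded number of paths. -/
theorem exists_linear_path {ℓ : ℕ} (hℓ : 1 ≤ ℓ) (hℓk : 2 * ℓ < k) (H : KGraph V k)
    {R : Finset (Fin k → V)} (hR : R ⊆ H.tuples) {ε : ℝ} (hε : 0 < ε)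
    (hRε : ε * (H.verts.card : ℝ) ^ k ≤ R.card) (j₀ : Fin k)
    (hn : 16 * (k : ℝ) ^ 2 < ε * H.verts.card) :
    ∃ (r : ℕ) (Z : Finset V), 1 ≤ r ∧ H.IsPathSet ℓ Z ∧ Z.card = ℓ + r * (2 * (k - ℓ)) ∧
      ε / (16 * k ^ 2) * H.verts.card ≤ Z.card ∧ (∀ z ∈ Z, ∃ f ∈ R, ∃ i, f i = z) ∧
      ∀ A : Finset V, (∀ f ∈ R, ∀ i, f i ∈ A ↔ i = j₀) → (Z ∩ A).card = r := by
  have hk0 : (0 : ℝ) < k := by exact_mod_cast (show 0 < k by omega)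
  have hk : (0 : ℝ) < 16 * (k : ℝ) ^ 2 := by
    positivity
  have hx : 16 * (k : ℝ) ^ 2 * (ε / (16 * k ^ 2) * H.verts.card) = ε * H.verts.card := by
    field_simp
  obtain ⟨x, hxd⟩ : ∃ x, x = ε / (16 * (k : ℝ) ^ 2) * H.verts.card := ⟨_, rfl⟩
  rw [← hxd] at hx ⊢
  have hx1 : 1 < x := by nlinarith
  have hr : 1 ≤ ⌊x⌋₊ := Nat.le_floor (by simpa using hx1.le)
  have hfl := Nat.floor_le (zero_le_one.trans hx1.le)
  obtain ⟨Z, h1, h2, h3, h4⟩ := exists_long_path hℓ hℓk H hR hε hRε j₀ hr (by nlinarith)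
  refine ⟨_, Z, hr, h1, h2, ?_, h3, h4⟩
  have h5 : ⌊x⌋₊ + 1 ≤ Z.card := by
    have : ⌊x⌋₊ * 1 ≤ ⌊x⌋₊ * (2 * (k - ℓ)) := Nat.mul_le_mul_left _ (by omega)
    omega
  have h6 : ((⌊x⌋₊ : ℝ) + 1) ≤ Z.card := by exact_mod_cast h5
  exact (Nat.lt_floor_add_one x).le.trans h6

theorem exists_path_count {k : ℕ} {ε : ℝ} (hε : 0 < ε) (hk : 0 < k) : ∃ p : ℕ, ∀ n : ℕ, p < n →
    16 * (k : ℝ) ^ 2 < ε * n ∧ (n : ℝ) < p * (ε / (16 * k ^ 2) * n) := by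
  have hk0 : (0 : ℝ) < k := by exact_mod_cast hk
  obtain ⟨p, hp⟩ := exists_nat_gt (16 * (k : ℝ) ^ 2 / ε)
  rw [div_lt_iff₀ hε] at hp
  refine ⟨p, fun n hn => ?_⟩
  have hn' : (p : ℝ) < n := by exact_mod_cast hn
  have hn0 : (0 : ℝ) < n := lt_of_le_of_lt (Nat.cast_nonneg p) hn'
  refine ⟨by nlinarith, ?_⟩
  rw [show (p : ℝ) * (ε / (16 * k ^ 2) * n) = (p * ε) * n / (16 * k ^ 2) by ring,
    lt_div_iff₀ (by positivity)]
  nlinarith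

/-- Boundedly many disjoint paths inside `W` hit almost all edges inside `W`. -/
theorem exists_cover_sparse.{u} {k ℓ : ℕ} (hℓ : 1 ≤ ℓ) (hℓk : 2 * ℓ < k) {ε : ℝ} (hε : 0 < ε) :
    ∃ p : ℕ, ∀ (V : Type u) [DecidableEq V] (H : KGraph V k), p < H.verts.card →
      ∀ W : Finset V, ∃ X ⊆ W, H.Covered ℓ p X ∧
        ((H.tuples.filter fun f => ∀ i, f i ∈ W \ X).card : ℝ) ≤ ε * (H.verts.card : ℝ) ^ k := by
  obtain ⟨p, hp⟩ := exists_path_count (k := k) hε (by omega)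
  refine ⟨p, fun V _ H hn W => ?_⟩
  suffices hstep : _ by
    obtain ⟨X, h1, h2, h3⟩ := Covered.exists_of_extend (H := H) (ℓ := ℓ) (· ⊆ W)
      (fun X => ((H.tuples.filter fun f => ∀ i, f i ∈ W \ X).card : ℝ) ≤
        ε * (H.verts.card : ℝ) ^ k) (Finset.empty_subset _) hstep (hp _ hn).2
    exact ⟨X, h2, h1, h3⟩
  intro X hX hD
  obtain ⟨r, Z, -, hZ, -, hc, hmem, -⟩ := exists_linear_path hℓ hℓk H (Finset.filter_subset _ _) hε
    (not_le.1 hD).le ⟨0, by omega⟩ (hp _ hn).1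
  have hZW : Z ⊆ W \ X := by
    intro z hz
    obtain ⟨f, hf, i, rfl⟩ := hmem z hz
    exact (Finset.mem_filter.1 hf).2 i
  exact ⟨Z, hZ, Finset.disjoint_of_subset_right hZW Finset.disjoint_sdiff,
    Finset.union_subset hX (hZW.trans Finset.sdiff_subset), hc⟩

theorem card_le_card_avoiding (H : KGraph V k) (hk : 2 ≤ k) (j₀ : Fin k) (a : V)
    (U Y : Finset V) {β : ℝ}
    (hdeg : β * (H.verts.card : ℝ) ^ (k - 1) ≤
      ((H.tuples.filter fun f => f j₀ = a ∧ ∀ i, i ≠ j₀ → f i ∈ U).card : ℝ))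
    (hY : 2 * k * (Y.card : ℝ) ≤ β * H.verts.card) :
    β / 2 * (H.verts.card : ℝ) ^ (k - 1) ≤
      ((H.tuples.filter fun f => f j₀ = a ∧ ∀ i, i ≠ j₀ → f i ∈ U \ Y).card : ℝ) := by
  have h1 := card_filter_fixed_hit_le H.verts {j₀} (fun _ => a) Y
  rw [Fintype.card_fin, Finset.card_singleton] at h1
  have h2 : (H.tuples.filter fun f => f j₀ = a ∧ ∀ i, i ≠ j₀ → f i ∈ U).card ≤
      (H.tuples.filter fun f => f j₀ = a ∧ ∀ i, i ≠ j₀ → f i ∈ U \ Y).card +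
        k * (Y.card * H.verts.card ^ (k - 1 - 1)) := by
    refine le_trans ?_ (Nat.add_le_add_left h1 _)
    refine le_trans (Finset.card_le_card ?_) (Finset.card_union_le _ _)
    intro f hf
    obtain ⟨hf, hfa, hfU⟩ := Finset.mem_filter.1 hf
    by_cases h : ∃ j, j ∉ ({j₀} : Finset (Fin k)) ∧ f j ∈ Y
    · refine Finset.mem_union_right _ ((@Finset.mem_filter _ _ (_) _ _).2
        ⟨Fintype.mem_piFinset.2 fun i => mem_verts_of_mem_tuples hf i, fun i hi => ?_, h⟩)
      rw [Finset.mem_singleton.1 hi, hfa]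
    · push Not at h
      refine Finset.mem_union_left _ (Finset.mem_filter.2 ⟨hf, hfa, fun i hi => ?_⟩)
      exact Finset.mem_sdiff.2 ⟨hfU i hi, h i (by simpa using hi)⟩
  have h3 : ((H.tuples.filter fun f => f j₀ = a ∧ ∀ i, i ≠ j₀ → f i ∈ U).card : ℝ) ≤
      (H.tuples.filter fun f => f j₀ = a ∧ ∀ i, i ≠ j₀ → f i ∈ U \ Y).card +
        k * (Y.card * H.verts.card ^ (k - 1 - 1)) := by exact_mod_cast h2
  have h4 : (H.verts.card : ℝ) ^ (k - 1) = (H.verts.card : ℝ) ^ (k - 1 - 1) * H.verts.card := by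
    rw [← pow_succ]; congr 1; omega
  have h5 : (0 : ℝ) ≤ (H.verts.card : ℝ) ^ (k - 1 - 1) := by positivity
  rw [h4] at hdeg ⊢
  nlinarith

/-- Vertices of `A` with large degree into `U` can almost all be covered by boundedly many paths
which use vertices of `U` otherwise, with `2 * (k - ℓ)` vertices for each vertex of `A`. -/
theorem exists_cover_of_large_degree.{u} {k ℓ : ℕ} (hℓ : 1 ≤ ℓ) (hℓk : 2 * ℓ < k) {β ε : ℝ}
    (hβ : 0 < β) (hε : 0 < ε) : ∃ p : ℕ, ∀ (V : Type u) [DecidableEq V] (H : KGraph V k),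
      p < H.verts.card → ∀ (j₀ : Fin k) (A U W : Finset V), A ⊆ W →
      (∀ a ∈ A, β * (H.verts.card : ℝ) ^ (k - 1) ≤
        ((H.tuples.filter fun f => f j₀ = a ∧ ∀ i, i ≠ j₀ → f i ∈ U).card : ℝ)) →
      2 * k * (2 * k + 1) * (W.card : ℝ) ≤ β * H.verts.card →
      ∃ X ⊆ A ∪ (U \ W), H.Covered ℓ p X ∧
        (2 * (k - ℓ) : ℕ) * (A.card : ℝ) ≤ X.card + (2 * (k - ℓ) : ℕ) * (ε * H.verts.card) := by
  have hε' : 0 < ε * (β / 2) := by positivity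
  obtain ⟨p, hp⟩ := exists_path_count (k := k) hε' (by omega)
  refine ⟨p, fun V _ H hn j₀ A U W hAW hA hW => ?_⟩
  suffices hstep : _ by
    -- The lower bound on `X.card` is the gain wanted at the end. The upper bound keeps `W ∪ X` so
    -- small that vertices of `A` retain half of their degree outside it.
    obtain ⟨X, h1, ⟨h2, h3, -⟩, h4⟩ := Covered.exists_of_extend (H := H) (ℓ := ℓ)
      (fun X => X ⊆ A ∪ (U \ W) ∧ 2 * (k - ℓ) * (X ∩ A).card ≤ X.card ∧
        X.card ≤ 2 * k * (X ∩ A).card)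
      (fun X => ((A \ X).card : ℝ) ≤ ε * H.verts.card) (by simp) hstep (hp _ hn).2
    refine ⟨X, h2, h1, ?_⟩
    have h5 : (A.card : ℝ) = (X ∩ A).card + (A \ X).card := by
      rw [← Finset.card_sdiff_add_card_inter A X, Finset.inter_comm]; push_cast; ring
    have h3' : (2 * (k - ℓ) : ℕ) * ((X ∩ A).card : ℝ) ≤ X.card := by exact_mod_cast h3
    rw [h5, mul_add]
    gcongr
  rintro X ⟨hX, hXl, hXu⟩ hD
  have hYcard : ((W ∪ X).card : ℝ) ≤ (2 * k + 1) * W.card := by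
    have h1 : (X ∩ A).card ≤ W.card :=
      Finset.card_le_card (Finset.inter_subset_right.trans hAW)
    have h2 := Finset.card_union_le W X
    have h3 : 2 * k * (X ∩ A).card ≤ 2 * k * W.card := Nat.mul_le_mul_left _ h1
    have h4 : (W ∪ X).card ≤ (2 * k + 1) * W.card := by rw [add_mul, one_mul]; omega
    exact_mod_cast h4
  have hRcard : ε * (β / 2) * (H.verts.card : ℝ) ^ k ≤ ((H.tuples.filter fun f =>
      f j₀ ∈ A \ X ∧ ∀ i, i ≠ j₀ → f i ∈ U \ (W ∪ X)).card : ℝ) := by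
    have hfib : (H.tuples.filter fun f =>
        f j₀ ∈ A \ X ∧ ∀ i, i ≠ j₀ → f i ∈ U \ (W ∪ X)).card =
        ∑ a ∈ A \ X, (H.tuples.filter fun f => f j₀ = a ∧
          ∀ i, i ≠ j₀ → f i ∈ U \ (W ∪ X)).card := by
      rw [Finset.card_eq_sum_card_fiberwise (f := fun f => f j₀) (t := A \ X)
        fun f hf => (Finset.mem_filter.1 hf).2.1]
      refine Finset.sum_congr rfl fun a ha => ?_
      congr 1
      ext f
      simp only [Finset.mem_filter]
      constructor
      · rintro ⟨⟨h1, -, h2⟩, h3⟩; exact ⟨h1, h3, h2⟩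
      · rintro ⟨h1, h2, h3⟩; exact ⟨⟨h1, h2 ▸ ha, h3⟩, h2⟩
    rw [hfib, Nat.cast_sum]
    have hge : ∀ a ∈ A \ X, β / 2 * (H.verts.card : ℝ) ^ (k - 1) ≤
        ((H.tuples.filter fun f => f j₀ = a ∧ ∀ i, i ≠ j₀ → f i ∈ U \ (W ∪ X)).card : ℝ) := by
      intro a ha
      refine card_le_card_avoiding H (by omega) j₀ a U (W ∪ X)
        (hA a (Finset.mem_sdiff.1 ha).1) (le_trans ?_ hW)
      have := mul_le_mul_of_nonneg_left hYcard (show (0 : ℝ) ≤ 2 * k by positivity)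
      linarith
    refine le_trans ?_ (Finset.card_nsmul_le_sum _ _ _ hge)
    rw [nsmul_eq_mul]
    have hpow : (H.verts.card : ℝ) ^ k = (H.verts.card : ℝ) ^ (k - 1) * H.verts.card := by
      rw [← pow_succ]; congr 1; omega
    have := mul_le_mul_of_nonneg_right (not_le.1 hD).le
      (show 0 ≤ β / 2 * (H.verts.card : ℝ) ^ (k - 1) by positivity)
    rw [hpow]
    linarith
  obtain ⟨r, Z, hr, hZ, hZc, hc, hmem, hZA⟩ := exists_linear_path hℓ hℓk H
    (Finset.filter_subset _ _) hε' hRcard j₀ (hp _ hn).1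
  have hZmem : ∀ z ∈ Z, z ∈ A ∪ (U \ W) ∧ z ∉ X := by
    intro z hz
    obtain ⟨f, hf, i, rfl⟩ := hmem z hz
    obtain ⟨-, hf0, hfi⟩ := Finset.mem_filter.1 hf
    by_cases hi : i = j₀
    · subst hi
      rw [Finset.mem_sdiff] at hf0
      exact ⟨Finset.mem_union_left _ hf0.1, hf0.2⟩
    · have := hfi i hi
      rw [Finset.mem_sdiff, Finset.mem_union] at this
      push Not at this
      exact ⟨Finset.mem_union_right _ (Finset.mem_sdiff.2 ⟨this.1, this.2.1⟩), this.2.2⟩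
  have hXZ : Disjoint X Z := Finset.disjoint_right.2 fun z hz => (hZmem z hz).2
  have hZA : (Z ∩ A).card = r := by
    refine hZA A fun f hf i => ?_
    obtain ⟨-, hf0, hfi⟩ := Finset.mem_filter.1 hf
    refine ⟨fun h => ?_, fun h => h ▸ (Finset.mem_sdiff.1 hf0).1⟩
    by_contra hi
    have := (Finset.mem_sdiff.1 (hfi i hi)).2
    exact this (Finset.mem_union_left _ (hAW h))
  refine ⟨Z, hZ, hXZ, ⟨Finset.union_subset hX fun z hz => (hZmem z hz).1, ?_, ?_⟩, hc⟩
  all_goals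
    rw [Finset.union_inter_distrib_right, Finset.card_union_of_disjoint hXZ,
      Finset.card_union_of_disjoint (Finset.disjoint_of_subset_left Finset.inter_subset_left
        (Finset.disjoint_of_subset_right Finset.inter_subset_left hXZ)), hZA, hZc, mul_add]
  · rw [mul_comm r]; omega
  · have : ℓ + r * (2 * (k - ℓ)) ≤ 2 * k * r := by
      obtain ⟨d, rfl⟩ : ∃ d, k = ℓ + d := ⟨k - ℓ, by omega⟩
      rw [Nat.add_sub_cancel_left]
      nlinarith
    omega

end Covers

/-! ### Degree counting and the extremality criterion -/

section Counting

variable {V : Type*} [DecidableEq V] {k : ℕ}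

theorem pow_sub_le_card_injective (U : Finset V) (m : ℕ) :
    (U.card + 1 - m) ^ m ≤
      ((Fintype.piFinset fun _ : Fin m => U).filter Function.Injective).card := by
  have h : Fintype.card (Fin m ↪ U) = U.card.descFactorial m := by
    rw [Fintype.card_embedding_eq]; simp
  refine (Nat.pow_sub_le_descFactorial _ _).trans ?_
  rw [← h, ← Finset.card_univ]
  refine Finset.card_le_card_of_injOn (fun e i => (e i : V)) (fun e _ => ?_) fun e _ e' _ h => ?_
  · simp only [Finset.coe_filter, Fintype.mem_piFinset, Set.mem_ofPred_eq]
    exact ⟨fun i => (e i).2, fun i j hij => e.injective (Subtype.ext hij)⟩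
  · ext i
    exact congrFun h i

theorem minDegree_le_degree (H : KGraph V k) {S : Finset V} (hS : S ⊆ H.verts) :
    H.minDegree S.card ≤ H.degree S :=
  Nat.sInf_le ⟨S, hS, rfl, rfl⟩

theorem degree_le_card_extensions {m : ℕ} (H : KGraph V (m + 1)) {g : Fin m → V}
    (hg : Function.Injective g) :
    H.degree (Finset.univ.image g) ≤ (H.tuples.filter fun f => Fin.tail f = g).card := by
  refine (Finset.card_le_card (t := (H.tuples.filter fun f => Fin.tail f = g).image
    fun f => Finset.univ.image f) ?_).trans Finset.card_image_le
  intro e he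
  obtain ⟨he, hge⟩ := Finset.mem_filter.1 he
  obtain ⟨a, ha, rfl⟩ := Finset.exists_eq_insert_iff.2 ⟨hge, by
    rw [Finset.card_image_of_injective _ hg, H.edge_card e he]; simp⟩
  have him : Finset.univ.image (Fin.cons a g : Fin (m + 1) → V) =
      insert a (Finset.univ.image g) := by
    ext z
    simp only [Finset.mem_image, Finset.mem_univ, true_and, Fin.exists_fin_succ, Fin.cons_zero,
      Fin.cons_succ, Finset.mem_insert]
    rw [eq_comm]
  refine Finset.mem_image.2 ⟨Fin.cons a g, Finset.mem_filter.2 ⟨mem_tuples.2 ⟨?_, him ▸ he⟩,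
    Fin.tail_cons _ _⟩, him⟩
  rw [Fin.cons_injective_iff]
  refine ⟨fun ⟨i, hi⟩ => ha (Finset.mem_image.2 ⟨i, Finset.mem_univ _, hi⟩), hg⟩

/-- Double count ordered edges whose last `k - 1` entries lie in `U`. The codegree gives at least `a
* n` for each injective tail; a first vertex contributes at most `|U| ^ (k - 1)`, and less than `β *
n ^ (k - 1)` when its degree is small. -/
theorem card_large_degree_ge {k : ℕ} (hk : 2 ≤ k) (H : KGraph V k) {a α β ε : ℝ} (ha : a ≤ 1)
    (hα : 0 < α) (hε : 0 < ε) (hβ : β = ε / 2 * α ^ (k - 1)) {U : Finset V} (hU : U ⊆ H.verts)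
    (hUα : α * H.verts.card ≤ U.card) (hn : (k : ℝ) ^ 2 < ε / 2 * (α * H.verts.card))
    (hdeg : a * H.verts.card ≤ (H.minDegree (k - 1) : ℝ)) :
    (a - ε) * H.verts.card ≤ ((H.verts.filter fun v => β * (H.verts.card : ℝ) ^ (k - 1) ≤
      ((H.tuples.filter fun f => f ⟨0, by omega⟩ = v ∧
        ∀ i, i ≠ ⟨0, by omega⟩ → f i ∈ U).card : ℝ)).card : ℝ) := by
  obtain ⟨m, rfl⟩ : ∃ m, k = m + 1 := ⟨k - 1, by omega⟩
  rw [Nat.add_sub_cancel] at *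
  change _ ≤ ((H.verts.filter fun v => β * (H.verts.card : ℝ) ^ m ≤
      ((H.tuples.filter fun f => f 0 = v ∧ ∀ i, i ≠ 0 → f i ∈ U).card : ℝ)).card : ℝ)
  set n : ℝ := (H.verts.card : ℝ) with hndef
  set u : ℝ := (U.card : ℝ) with hu
  set A := H.verts.filter fun v => β * n ^ m ≤
      ((H.tuples.filter fun f => f 0 = v ∧ ∀ i, i ≠ 0 → f i ∈ U).card : ℝ) with hA
  have hm0 : (0 : ℝ) ≤ m := Nat.cast_nonneg m
  push_cast at hn
  have hn0 : 0 < α * n := by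
    have : 0 < ε / 2 * (α * n) := lt_of_le_of_lt (by positivity) hn
    exact pos_of_mul_pos_right this (by positivity)
  have hn0' : 0 < n := pos_of_mul_pos_right hn0 hα.le
  have hu0 : 0 < u := hn0.trans_le hUα
  rcases le_or_gt a ε with haε | haε
  · exact (mul_nonpos_of_nonpos_of_nonneg (by linarith) hn0'.le).trans (Nat.cast_nonneg _)
  set T := H.tuples.filter fun f => ∀ i, i ≠ 0 → f i ∈ U with hT
  have upper : (T.card : ℝ) ≤ A.card * u ^ m + n * (β * n ^ m) := by
    have h1 : T.card = ∑ v ∈ H.verts,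
        (H.tuples.filter fun f => f 0 = v ∧ ∀ i, i ≠ 0 → f i ∈ U).card := by
      rw [Finset.card_eq_sum_card_fiberwise (f := fun f => f 0) (t := H.verts)
        fun f hf => mem_verts_of_mem_tuples (Finset.mem_filter.1 hf).1 0]
      refine Finset.sum_congr rfl fun v _ => ?_
      rw [Finset.filter_filter]
      congr 1
      ext f
      simp only [Finset.mem_filter]
      tauto
    have hfib : ∀ v, ((H.tuples.filter fun f => f 0 = v ∧ ∀ i, i ≠ 0 → f i ∈ U).card : ℝ) ≤
        u ^ m := by
      intro v
      have : (H.tuples.filter fun f => f 0 = v ∧ ∀ i, i ≠ 0 → f i ∈ U).card ≤ U.card ^ m := by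
        have : U.card ^ m = (Fintype.piFinset fun _ : Fin m => U).card := by simp
        rw [this]
        refine Finset.card_le_card_of_injOn Fin.tail (fun f hf => ?_) fun f hf f' hf' h => ?_
        · have := (Finset.mem_filter.1 hf).2.2
          exact Fintype.mem_piFinset.2 fun i => this _ (Fin.succ_ne_zero i)
        · rw [← Fin.cons_self_tail f, ← Fin.cons_self_tail f', h,
            (Finset.mem_filter.1 hf).2.1, (Finset.mem_filter.1 hf').2.1]
      rw [hu]
      exact_mod_cast this
    rw [h1, Nat.cast_sum, ← Finset.sum_filter_add_sum_filter_not H.verts fun v => β * n ^ m ≤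
      ((H.tuples.filter fun f => f 0 = v ∧ ∀ i, i ≠ 0 → f i ∈ U).card : ℝ)]
    refine add_le_add ?_ ?_
    · refine (Finset.sum_le_card_nsmul _ _ _ fun v _ => hfib v).trans_eq ?_
      rw [nsmul_eq_mul]
    · refine (Finset.sum_le_card_nsmul _ _ (β * n ^ m) fun v hv =>
        (not_le.1 (Finset.mem_filter.1 hv).2).le).trans ?_
      rw [nsmul_eq_mul]
      refine mul_le_mul_of_nonneg_right ?_ (by rw [hβ]; positivity)
      exact Nat.cast_le.2 (Finset.card_filter_le _ _)
  have lower : a * n * (u - m) ^ m ≤ T.card := by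
    have hmaps : ∀ f ∈ T, Fin.tail f ∈
        (Fintype.piFinset fun _ : Fin m => U).filter Function.Injective := by
      intro f hf
      obtain ⟨hf, hfU⟩ := Finset.mem_filter.1 hf
      exact Finset.mem_filter.2 ⟨Fintype.mem_piFinset.2 fun i => hfU _ (Fin.succ_ne_zero i),
        (mem_tuples.1 hf).1.comp (Fin.succ_injective m)⟩
    rw [Finset.card_eq_sum_card_fiberwise hmaps, Nat.cast_sum]
    have hge : ∀ g ∈ (Fintype.piFinset fun _ : Fin m => U).filter Function.Injective,
        a * n ≤ ((T.filter fun f => Fin.tail f = g).card : ℝ) := by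
      intro g hg
      obtain ⟨hgU, hginj⟩ := Finset.mem_filter.1 hg
      rw [Fintype.mem_piFinset] at hgU
      have h1 : H.minDegree m ≤ H.degree (Finset.univ.image g) := by
        have := H.minDegree_le_degree (S := Finset.univ.image g) fun z hz => by
          obtain ⟨i, -, rfl⟩ := Finset.mem_image.1 hz
          exact hU (hgU i)
        rwa [Finset.card_image_of_injective _ hginj, Finset.card_univ, Fintype.card_fin] at this
      have h2 : (H.tuples.filter fun f => Fin.tail f = g).card ≤
          (T.filter fun f => Fin.tail f = g).card := by
        refine Finset.card_le_card fun f hf => ?_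
        obtain ⟨hf, hfg⟩ := Finset.mem_filter.1 hf
        refine Finset.mem_filter.2 ⟨Finset.mem_filter.2 ⟨hf, fun i hi => ?_⟩, hfg⟩
        obtain ⟨j, rfl⟩ := Fin.exists_succ_eq.2 hi
        have := hgU j
        rw [← hfg] at this
        exact this
      exact hdeg.trans (Nat.cast_le.2 (h1.trans ((H.degree_le_card_extensions hginj).trans h2)))
    refine le_trans ?_ (Finset.card_nsmul_le_sum _ _ _ hge)
    rw [nsmul_eq_mul, mul_comm]
    refine mul_le_mul_of_nonneg_right ?_ (by nlinarith)
    have h1 : ((U.card + 1 - m : ℕ) : ℝ) ^ m ≤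
        (((Fintype.piFinset fun _ : Fin m => U).filter Function.Injective).card : ℝ) := by
      exact_mod_cast pow_sub_le_card_injective U m
    refine le_trans (pow_le_pow_left₀ ?_ ?_ m) h1
    · nlinarith
    · have : U.card ≤ (U.card + 1 - m) + m := by omega
      have : (U.card : ℝ) ≤ ((U.card + 1 - m : ℕ) : ℝ) + m := by exact_mod_cast this
      rw [hu]; linarith
  -- Bernoulli's inequality: requiring the tail to be injective costs only a factor `1 - ε / 2`.
  have bern : u ^ m * (1 - ε / 2) ≤ (u - m) ^ m := by
    have h1 : (u - m) ^ m = u ^ m * (1 + -(m / u)) ^ m := by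
      rw [← mul_pow]; congr 1; field_simp; ring
    rw [h1]
    refine mul_le_mul_of_nonneg_left ?_ (by positivity)
    have hmu : m * m / u ≤ ε / 2 := by
      rw [div_le_iff₀ hu0]
      nlinarith
    have hmu' : (m : ℝ) / u ≤ 1 := by
      rw [div_le_one hu0]
      nlinarith
    have := one_add_mul_le_pow (a := -((m : ℝ) / u)) (by linarith) m
    refine le_trans ?_ this
    have : (m : ℝ) * -(m / u) = -(m * m / u) := by ring
    rw [this]; linarith
  have hβn : β * n ^ m ≤ ε / 2 * u ^ m := by
    rw [hβ, mul_assoc, ← mul_pow]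
    gcongr
  have hum : 0 < u ^ m := by positivity
  have h1 : a * n * (u ^ m * (1 - ε / 2)) ≤ A.card * u ^ m + n * (ε / 2 * u ^ m) :=
    (mul_le_mul_of_nonneg_left bern (by nlinarith)).trans (lower.trans (upper.trans
      (add_le_add le_rfl (mul_le_mul_of_nonneg_left hβn hn0'.le))))
  have h2 : u ^ m * (a * n * (1 - ε / 2)) ≤ u ^ m * (A.card + n * (ε / 2)) := by linarith
  have h3 := le_of_mul_le_mul_left h2 hum
  have : a * n * (ε / 2) ≤ n * (ε / 2) := by
    have : a * n ≤ 1 * n := mul_le_mul_of_nonneg_right ha hn0'.le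
    nlinarith
  linarith

theorem factorial_mul_edgesIn_le (H : KGraph V k) (B : Finset V) :
    k.factorial * H.edgesIn B ≤ (H.tuples.filter fun f => ∀ i, f i ∈ B).card := by
  rw [Finset.card_eq_sum_card_fiberwise (f := fun f => Finset.univ.image f)
    (t := H.edges.filter fun e => e ⊆ B), edgesIn, mul_comm, ← smul_eq_mul]
  · refine Finset.card_nsmul_le_sum _ _ _ fun e he => ?_
    obtain ⟨he, heB⟩ := Finset.mem_filter.1 he
    have e₀ := (e.equivFinOfCardEq (H.edge_card e he)).symm
    have hperm : k.factorial = (Finset.univ : Finset (Equiv.Perm (Fin k))).card := by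
      rw [Finset.card_univ, Fintype.card_perm, Fintype.card_fin]
    rw [hperm]
    have him : ∀ σ : Equiv.Perm (Fin k), Finset.univ.image (fun i => (e₀ (σ i) : V)) = e := by
      intro σ
      ext z
      simp only [Finset.mem_image, Finset.mem_univ, true_and]
      exact ⟨fun ⟨i, hi⟩ => hi ▸ (e₀ (σ i)).2, fun hz => ⟨σ.symm (e₀.symm ⟨z, hz⟩), by simp⟩⟩
    refine Finset.card_le_card_of_injOn (fun σ i => (e₀ (σ i) : V)) (fun σ _ => ?_)
      fun σ _ τ _ h => ?_
    · refine Finset.mem_filter.2 ⟨Finset.mem_filter.2 ⟨mem_tuples.2 ⟨?_, ?_⟩, ?_⟩, him σ⟩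
      · exact fun i j hij => σ.injective (e₀.injective (Subtype.ext hij))
      · rw [him]; exact he
      · exact fun i => heB (e₀ (σ i)).2
    · ext i
      have := e₀.injective (Subtype.ext (congrFun h i))
      rw [this]
  · intro f hf
    obtain ⟨hf, hfB⟩ := Finset.mem_filter.1 hf
    refine Finset.mem_coe.2 (Finset.mem_filter.2 ⟨(mem_tuples.1 hf).2, fun z hz => ?_⟩)
    obtain ⟨i, -, rfl⟩ := Finset.mem_image.1 hz
    exact hfB i

theorem card_tuples_le_add (H : KGraph V k) (B C : Finset V) :
    (H.tuples.filter fun f => ∀ i, f i ∈ B).card ≤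
      (H.tuples.filter fun f => ∀ i, f i ∈ C).card +
        k * ((B \ C).card * H.verts.card ^ (k - 1)) := by
  have h1 := card_filter_hit_le (fun _ : Fin k => H.verts) (fun _ => le_rfl) (B \ C)
  rw [Fintype.card_fin] at h1
  refine le_trans ?_ (Nat.add_le_add_left h1 _)
  refine le_trans (Finset.card_le_card ?_) (Finset.card_union_le _ _)
  intro f hf
  obtain ⟨hf, hfB⟩ := Finset.mem_filter.1 hf
  by_cases h : ∀ i, f i ∈ C
  · exact Finset.mem_union_left _ (Finset.mem_filter.2 ⟨hf, h⟩)
  · push Not at h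
    obtain ⟨j, hj⟩ := h
    exact Finset.mem_union_right _ ((@Finset.mem_filter _ _ (_) _ _).2
      ⟨Fintype.mem_piFinset.2 fun i => mem_verts_of_mem_tuples hf i,
        j, Finset.mem_sdiff.2 ⟨hfB j, hj⟩⟩)

/-- The complement of `A` has nearly the required size or more: shrink it, or add at most `η * n`
vertices, which creates at most `k * η * n ^ k` ordered edges. Each edge has `k!` orderings. -/
theorem isExtremal_of_card_tuples_le {ℓ : ℕ} (hk : 1 ≤ k) (hℓk : ℓ < k) (H : KGraph V k)
    {A : Finset V} (hA : A ⊆ H.verts) {η Δ : ℝ} (hη : 0 ≤ η)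
    (hAη : (A.card : ℝ) ≤ H.verts.card / (2 * ((k : ℝ) - ℓ)) + η * H.verts.card)
    (hcard : ((H.tuples.filter fun f => ∀ i, f i ∈ H.verts \ A).card : ℝ) +
      k * η * (H.verts.card : ℝ) ^ k ≤ k.factorial * (Δ * (H.verts.card : ℝ) ^ k)) :
    H.IsExtremal ℓ Δ := by
  set n : ℝ := (H.verts.card : ℝ) with hn
  have hn0 : 0 ≤ n := Nat.cast_nonneg _
  have hkℓ : (1 : ℝ) ≤ (k : ℝ) - ℓ := by
    have : (ℓ : ℝ) + 1 ≤ k := by exact_mod_cast hℓk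
    linarith
  have hx : (2 * ((k : ℝ) - ℓ) - 1) / (2 * ((k : ℝ) - ℓ)) * n = n - n / (2 * ((k : ℝ) - ℓ)) := by
    field_simp
  have hdiv : 0 ≤ n / (2 * ((k : ℝ) - ℓ)) := by positivity
  have hx0 : 0 ≤ n - n / (2 * ((k : ℝ) - ℓ)) := by
    rw [← hx]
    have : 0 ≤ 2 * ((k : ℝ) - ℓ) - 1 := by linarith
    positivity
  obtain ⟨b, hb⟩ : ∃ b, b = ⌊(2 * ((k : ℝ) - ℓ) - 1) / (2 * ((k : ℝ) - ℓ)) * n⌋₊ := ⟨_, rfl⟩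
  have hbn : (b : ℝ) ≤ n - n / (2 * ((k : ℝ) - ℓ)) := by
    rw [hb, hx]; exact Nat.floor_le hx0
  have hbn' : b ≤ H.verts.card := by
    have : (b : ℝ) ≤ n := by linarith
    exact Nat.cast_le.1 this
  have hcC : ((H.verts \ A).card : ℝ) = n - A.card := by
    rw [Finset.card_sdiff_of_subset hA, Nat.cast_sub (Finset.card_le_card hA), hn]
  obtain ⟨B, hB, hBb, hBC⟩ : ∃ B ⊆ H.verts, B.card = b ∧
      ((B \ (H.verts \ A)).card : ℝ) ≤ η * n := by
    rcases le_total b (H.verts \ A).card with h | h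
    · obtain ⟨B, hB, hBb⟩ := Finset.exists_subset_card_eq h
      refine ⟨B, hB.trans Finset.sdiff_subset, hBb, ?_⟩
      rw [Finset.sdiff_eq_empty_iff_subset.2 hB]
      simp; positivity
    · obtain ⟨B, h1, h2, h3⟩ := Finset.exists_subsuperset_card_eq
        (Finset.sdiff_subset (s := H.verts) (t := A)) h hbn'
      refine ⟨B, h2, h3, ?_⟩
      rw [Finset.card_sdiff_of_subset h1, Nat.cast_sub (Finset.card_le_card h1), h3, hcC]
      linarith
  refine ⟨B, hB, hBb.trans hb, ?_⟩
  have h1 : (k.factorial * H.edgesIn B : ℝ) ≤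
      (H.tuples.filter fun f => ∀ i, f i ∈ H.verts \ A).card +
        k * ((B \ (H.verts \ A)).card * n ^ (k - 1)) := by
    rw [hn]
    exact_mod_cast (factorial_mul_edgesIn_le H B).trans (card_tuples_le_add H B (H.verts \ A))
  have h2 : n ^ k = n * n ^ (k - 1) := by rw [← pow_succ']; congr 1; omega
  have h3 : (k : ℝ) * ((B \ (H.verts \ A)).card * n ^ (k - 1)) ≤ k * η * n ^ k := by
    rw [h2, mul_assoc, ← mul_assoc η]
    gcongr
  have hf : (0 : ℝ) < k.factorial := by exact_mod_cast Nat.factorial_pos k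
  exact le_of_mul_le_mul_left (by linarith) hf

/-- Sort ordered edges by the parts containing their entries. For each pattern, at most `e` avoid
`Q` and at most `k * |Q| * w ^ (k - 1)` meet it. Keeping `h` signed lets the bounds on `|Q|` average
out to `∑ i, h i`. -/
theorem card_tuples_avoiding_le (H : KGraph V k) (hk : 1 ≤ k) {K w : ℕ} (A : Finset V)
    (W : Fin K → Finset V) (hWw : ∀ i, (W i).card ≤ w) (hcov : H.verts ⊆ Finset.univ.biUnion W)
    {e s : ℝ} {h : Fin K → ℝ}
    (hQ : ∀ i : Fin k → Fin K, ∃ Q : Finset V, ((H.tuples.filter fun f =>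
      ∀ j, f j ∈ ((Finset.univ.image i).biUnion W \ A) \ Q).card : ℝ) ≤ e ∧
      (Q.card : ℝ) ≤ s - ∑ j, h (i j)) :
    ((H.tuples.filter fun f => ∀ j, f j ∈ H.verts \ A).card : ℝ) ≤
      K ^ k * (e + k * w ^ (k - 1) * s) - k ^ 2 * (K * w) ^ (k - 1) * ∑ i, h i := by
  have hsub : (H.tuples.filter fun f => ∀ j, f j ∈ H.verts \ A) ⊆
      (Finset.univ : Finset (Fin k → Fin K)).biUnion
        fun i => H.tuples.filter fun f => ∀ j, f j ∈ W (i j) \ A := by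
    intro f hf
    obtain ⟨hf, hfA⟩ := Finset.mem_filter.1 hf
    have : ∀ j, ∃ x, f j ∈ W x := fun j => by
      simpa using hcov (Finset.mem_sdiff.1 (hfA j)).1
    choose i hi using this
    exact Finset.mem_biUnion.2 ⟨i, Finset.mem_univ _, Finset.mem_filter.2 ⟨hf, fun j =>
      Finset.mem_sdiff.2 ⟨hi j, (Finset.mem_sdiff.1 (hfA j)).2⟩⟩⟩
  have hone : ∀ i : Fin k → Fin K, ((H.tuples.filter fun f => ∀ j, f j ∈ W (i j) \ A).card : ℝ) ≤
      e + k * w ^ (k - 1) * (s - ∑ j, h (i j)) := by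
    intro i
    obtain ⟨Q, hQe, hQs⟩ := hQ i
    have h1 := card_filter_hit_le (fun j => W (i j)) (fun j => hWw (i j)) Q
    rw [Fintype.card_fin] at h1
    have h2 : (H.tuples.filter fun f => ∀ j, f j ∈ W (i j) \ A).card ≤
        (H.tuples.filter fun f => ∀ j, f j ∈ ((Finset.univ.image i).biUnion W \ A) \ Q).card +
          k * (Q.card * w ^ (k - 1)) := by
      refine le_trans ?_ (Nat.add_le_add_left h1 _)
      refine le_trans (Finset.card_le_card ?_) (Finset.card_union_le _ _)
      intro f hf
      obtain ⟨hf, hfW⟩ := Finset.mem_filter.1 hf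
      by_cases hq : ∃ j, f j ∈ Q
      · exact Finset.mem_union_right _ ((@Finset.mem_filter _ _ (_) _ _).2
          ⟨Fintype.mem_piFinset.2 fun j => (Finset.mem_sdiff.1 (hfW j)).1, hq⟩)
      · push Not at hq
        refine Finset.mem_union_left _ (Finset.mem_filter.2 ⟨hf, fun j => ?_⟩)
        have := Finset.mem_sdiff.1 (hfW j)
        exact Finset.mem_sdiff.2 ⟨Finset.mem_sdiff.2 ⟨Finset.mem_biUnion.2 ⟨i j,
          Finset.mem_image_of_mem _ (Finset.mem_univ _), this.1⟩, this.2⟩, hq j⟩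
    have h3 : ((H.tuples.filter fun f => ∀ j, f j ∈ W (i j) \ A).card : ℝ) ≤
        (H.tuples.filter fun f => ∀ j, f j ∈ ((Finset.univ.image i).biUnion W \ A) \ Q).card +
          k * (Q.card * w ^ (k - 1)) := by exact_mod_cast h2
    have h4 : (k : ℝ) * (Q.card * (w : ℝ) ^ (k - 1)) ≤
        k * w ^ (k - 1) * (s - ∑ j, h (i j)) := by
      rw [mul_comm (Q.card : ℝ), ← mul_assoc]
      exact mul_le_mul_of_nonneg_left hQs (by positivity)
    linarith
  have hsum : ∑ i : Fin k → Fin K, ∑ j, h (i j) = k * (K ^ (k - 1) * ∑ x, h x) := by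
    rw [Finset.sum_comm]
    have : ∀ j : Fin k, ∑ i : Fin k → Fin K, h (i j) = K ^ (k - 1) * ∑ x, h x := by
      intro j
      have := Fintype.sum_piFinset_apply h (Finset.univ : Finset (Fin K)) j
      simpa using this
    simp [this]
  calc ((H.tuples.filter fun f => ∀ j, f j ∈ H.verts \ A).card : ℝ)
      ≤ ∑ i : Fin k → Fin K, ((H.tuples.filter fun f => ∀ j, f j ∈ W (i j) \ A).card : ℝ) := by
        exact_mod_cast (Finset.card_le_card hsub).trans Finset.card_biUnion_le
    _ ≤ ∑ i : Fin k → Fin K, (e + k * w ^ (k - 1) * (s - ∑ j, h (i j))) :=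
        Finset.sum_le_sum fun i _ => hone i
    _ = K ^ k * (e + k * w ^ (k - 1) * s) - k ^ 2 * (K * w) ^ (k - 1) * ∑ i, h i := by
        rw [Finset.sum_add_distrib, ← Finset.mul_sum, Finset.sum_sub_distrib, hsum]
        simp only [Finset.sum_const, Finset.card_univ, Fintype.card_fun, Fintype.card_fin,
          nsmul_eq_mul, Nat.cast_pow]
        rw [mul_pow]
        ring

end Counting

/-! ### The exchange argument -/

/-- Discard the pieces in the parts of `J` and insert `X` and `Q`. Outside these parts `X` uses only
vertices missed by every `Y i`, and inside them it stays in `A`, which `Q` avoids; so nothing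
overlaps. -/
theorem covered_swap {V : Type*} [DecidableEq V] {k ℓ K p p₁ p₂ : ℕ} {H : KGraph V k}
    {W Y : Fin K → Finset V} (hW : ∀ i j, i ≠ j → Disjoint (W i) (W j)) (hYW : ∀ i, Y i ⊆ W i)
    (hY : ∀ i, H.Covered ℓ p (Y i)) (J : Finset (Fin K)) {A X Q : Finset V}
    (hX : H.Covered ℓ p₁ X) (hQ : H.Covered ℓ p₂ Q)
    (hXA : X ⊆ A ∩ J.biUnion W ∪ (H.verts \ Finset.univ.biUnion Y) \ J.biUnion W)
    (hQA : Q ⊆ J.biUnion W \ A) :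
    ∃ X', H.Covered ℓ (K * p + p₁ + p₂) X' ∧
      ∑ i, (Y i).card + X.card + Q.card ≤ X'.card + ∑ i ∈ J, (W i).card := by
  have hYd : ∀ i j, i ≠ j → Disjoint (Y i) (Y j) := fun i j hij =>
    Finset.disjoint_of_subset_left (hYW i) (Finset.disjoint_of_subset_right (hYW j) (hW i j hij))
  have hYJ : Disjoint (Jᶜ.biUnion Y) (J.biUnion W) := by
    rw [Finset.disjoint_biUnion_left]
    intro i hi
    rw [Finset.disjoint_biUnion_right]
    intro j hj
    exact Finset.disjoint_of_subset_left (hYW i)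
      (hW i j fun h => Finset.mem_compl.1 hi (h ▸ hj))
  have hYU : Jᶜ.biUnion Y ⊆ Finset.univ.biUnion Y :=
    Finset.biUnion_subset_biUnion_of_subset_left _ (Finset.subset_univ _)
  have hd₁ : Disjoint (Jᶜ.biUnion Y) X := by
    rw [Finset.disjoint_left]
    intro z hz hzX
    rcases Finset.mem_union.1 (hXA hzX) with h | h
    · exact Finset.disjoint_left.1 hYJ hz (Finset.mem_inter.1 h).2
    · exact (Finset.mem_sdiff.1 (Finset.mem_sdiff.1 h).1).2 (hYU hz)
  have hd₂ : Disjoint (Jᶜ.biUnion Y ∪ X) Q := by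
    rw [Finset.disjoint_left]
    intro z hz hzQ
    obtain ⟨hzJ, hzA⟩ := Finset.mem_sdiff.1 (hQA hzQ)
    rcases Finset.mem_union.1 hz with h | h
    · exact Finset.disjoint_left.1 hYJ h hzJ
    · rcases Finset.mem_union.1 (hXA h) with h | h
      · exact hzA (Finset.mem_inter.1 h).1
      · exact (Finset.mem_sdiff.1 h).2 hzJ
  refine ⟨_, (((Covered.biUnion Jᶜ Y (fun i _ => hY i) fun i _ j _ => hYd i j).mono
    (Nat.mul_le_mul_right _ ((Finset.card_le_univ _).trans_eq (Fintype.card_fin K)))).union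
    hX hd₁).union hQ hd₂, ?_⟩
  rw [Finset.card_union_of_disjoint hd₂, Finset.card_union_of_disjoint hd₁,
    Finset.card_biUnion fun i _ j _ => hYd i j, ← Finset.sum_add_sum_compl J fun i => (Y i).card]
  have : ∑ i ∈ J, (Y i).card ≤ ∑ i ∈ J, (W i).card :=
    Finset.sum_le_sum fun i _ => Finset.card_le_card (hYW i)
  omega

/-- This absorbs the factor `k ^ 2 * t` of the edge count into the `k!` orderings of an edge;
equality holds at `k = 3`, `ℓ = 1`. -/
theorem sq_mul_le_factorial {k ℓ : ℕ} (hk : 3 ≤ k) (hℓ : 1 ≤ ℓ) :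
    k ^ 2 * (2 * (k - ℓ)) ≤ 6 * k.factorial := by
  obtain ⟨m, rfl⟩ : ∃ m, k = m + 3 := ⟨k - 3, by omega⟩
  have h1 : 2 * (m + 3 - ℓ) ≤ 2 * (m + 2) := by omega
  have h2 : m + 3 ≤ 3 * (m + 1).factorial := by
    have := Nat.self_le_factorial (m + 1)
    omega
  calc (m + 3) ^ 2 * (2 * (m + 3 - ℓ)) ≤ (m + 3) ^ 2 * (2 * (m + 2)) := by gcongr
    _ = 2 * (m + 3) * (m + 2) * (m + 3) := by ring
    _ ≤ 2 * (m + 3) * (m + 2) * (3 * (m + 1).factorial) := by gcongr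
    _ = 6 * (m + 3).factorial := by
      rw [Nat.factorial_succ (m + 2), Nat.factorial_succ (m + 1)]; ring

theorem pow_le_two_mul_pow {k j : ℕ} (hk : 1 ≤ k) (hj : j ≤ k) {x y : ℝ} (hx : 0 ≤ x)
    (hy : 0 ≤ y) (hxy : y ≤ x * (1 + 1 / (2 * k))) : y ^ j ≤ 2 * x ^ j := by
  have hk0 : (0 : ℝ) < k := by exact_mod_cast hk
  have hexp : Real.exp (1 / 2) ≤ 2 := by
    have h1 : Real.exp (1 / 2) * Real.exp (1 / 2) = Real.exp 1 := by
      rw [← Real.exp_add]; norm_num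
    have h2 := Real.exp_one_lt_d9
    nlinarith [Real.exp_pos (1 / 2)]
  have h1 : (1 + 1 / (2 * k) : ℝ) ^ j ≤ 2 := by
    calc (1 + 1 / (2 * k) : ℝ) ^ j ≤ (1 + 1 / (2 * k) : ℝ) ^ k :=
          pow_le_pow_right₀ (by linarith [show (0 : ℝ) ≤ 1 / (2 * k) by positivity]) hj
      _ ≤ Real.exp (1 / (2 * k)) ^ k := by
          gcongr
          linarith [Real.add_one_le_exp (1 / (2 * k) : ℝ)]
      _ = Real.exp (1 / 2) := by
          rw [← Real.exp_nat_mul]; congr 1; field_simp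
      _ ≤ 2 := hexp
  calc y ^ j ≤ (x * (1 + 1 / (2 * k))) ^ j := by gcongr
    _ = x ^ j * (1 + 1 / (2 * k)) ^ j := mul_pow _ _ _
    _ ≤ x ^ j * 2 := by gcongr
    _ = 2 * x ^ j := mul_comm _ _

/-- If no exchange of at most `k` parts against new paths increases the coverage substantially,
then `H` is extremal. -/
theorem isExtremal_of_no_gain {V : Type*} [DecidableEq V] {k ℓ K w : ℕ} (hk : 3 ≤ k)
    (hℓ : 1 ≤ ℓ) (hℓk : 2 * ℓ < k) (H : KGraph V k) {γ η : ℝ} (hγ : 0 < γ)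
    (hη : η = γ / (2 * k * (k + 1) + k)) (hKw : (K * w : ℝ) ≤ H.verts.card * (1 + 1 / (2 * k)))
    (hK : 0 < K) {W : Fin K → Finset V} (hWw : ∀ i, (W i).card ≤ w)
    (hWd : ∀ i j, i ≠ j → Disjoint (W i) (W j)) (hWV : Finset.univ.biUnion W = H.verts)
    {A : Finset V} (hA : A ⊆ H.verts)
    (hAγ : (1 / (2 * ((k : ℝ) - ℓ)) - γ - γ / 24) * H.verts.card ≤ A.card)
    (hgain : ∀ J : Finset (Fin K), J.card ≤ k → ∃ Q : Finset V,
      ((H.tuples.filter fun f => ∀ j, f j ∈ (J.biUnion W \ A) \ Q).card : ℝ) ≤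
        γ / (K : ℝ) ^ k * (H.verts.card : ℝ) ^ k ∧
      (Q.card : ℝ) ≤ η * w -
        ∑ i ∈ J, ((2 * (k - ℓ) : ℕ) * ((A ∩ W i).card : ℝ) - (W i).card)) :
    H.IsExtremal ℓ (14 * γ) := by
  set n : ℝ := (H.verts.card : ℝ) with hn
  set t : ℕ := 2 * (k - ℓ) with ht
  have hn0 : 0 ≤ n := Nat.cast_nonneg _
  have ht' : (t : ℝ) = 2 * ((k : ℝ) - ℓ) := by
    rw [ht, Nat.cast_mul, Nat.cast_sub (by omega)]; norm_num
  have ht2 : (2 : ℝ) ≤ t := by exact_mod_cast (show 2 ≤ t by omega)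
  have hk0 : (0 : ℝ) < k := by exact_mod_cast (show 0 < k by omega)
  have hK0 : (0 : ℝ) < K := by exact_mod_cast hK
  have hη0 : 0 < η := by rw [hη]; positivity
  set h : Fin K → ℝ := fun i => t * ((A ∩ W i).card : ℝ) - (W i).card with hh
  have hsum : ∑ i, h i = t * A.card - n := by
    have hWn : ∑ i, ((W i).card : ℝ) = n := by
      rw [hn, ← hWV, Finset.card_biUnion fun i _ j _ => hWd i j]; push_cast; rfl
    have hAn : ∑ i, ((A ∩ W i).card : ℝ) = A.card := by
      have : A = Finset.univ.biUnion fun i => A ∩ W i := by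
        rw [← Finset.inter_biUnion, hWV, Finset.inter_eq_left.2 hA]
      conv_rhs => rw [this]
      rw [Finset.card_biUnion fun i _ j _ hij => Finset.disjoint_of_subset_left
        Finset.inter_subset_right (Finset.disjoint_of_subset_right Finset.inter_subset_right
          (hWd i j hij))]
      push_cast; rfl
    rw [hh, Finset.sum_sub_distrib, ← Finset.mul_sum, hWn, hAn]
  clear_value h
  -- Exchanging a single part already bounds its surplus, because `|Q| ≥ 0`.
  have hsingle : ∀ i, h i ≤ η * w := by
    intro i
    obtain ⟨Q, -, hQ⟩ := hgain {i} (by simp; omega)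
    rw [Finset.sum_singleton] at hQ
    have : (0 : ℝ) ≤ Q.card := Nat.cast_nonneg _
    linarith
  have hcount := card_tuples_avoiding_le H (by omega) A W hWw hWV.ge
    (e := γ / (K : ℝ) ^ k * n ^ k) (s := (k + 1) * (η * w)) (h := h) (by
      intro i
      obtain ⟨Q, hQe, hQs⟩ := hgain (Finset.univ.image i)
        (Finset.card_image_le.trans_eq (by simp))
      refine ⟨Q, hQe, hQs.trans ?_⟩
      -- A pattern may repeat a part, whereas `J` counts it once. As `η * w - h` is nonnegative,
      -- summing with repetition only increases it; this is why `s` carries the factor `k + 1`.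
      have h1 := Finset.sum_image_le_of_nonneg (s := Finset.univ) (g := i)
        (f := fun x => η * w - h x) fun x _ => sub_nonneg.2 (hsingle x)
      rw [Finset.sum_sub_distrib, Finset.sum_sub_distrib] at h1
      simp only [Finset.sum_const, Finset.card_univ, Fintype.card_fin, nsmul_eq_mul] at h1
      have h2 : 0 ≤ ((Finset.univ.image i).card : ℝ) * (η * w) := by positivity
      linarith)
  have hpow₁ : ((K : ℝ) * w) ^ k ≤ 2 * n ^ k :=
    pow_le_two_mul_pow (by omega) le_rfl hn0 (by positivity) hKw
  have hpow₂ : ((K : ℝ) * w) ^ (k - 1) ≤ 2 * n ^ (k - 1) :=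
    pow_le_two_mul_pow (by omega) (Nat.sub_le _ _) hn0 (by positivity) hKw
  have hlow : n - t * A.card ≤ t * (γ + γ / 24) * n := by
    have h1 := mul_le_mul_of_nonneg_left hAγ (show (0 : ℝ) ≤ t by linarith)
    rw [← ht'] at h1
    have h2 : (t : ℝ) * ((1 / t - γ - γ / 24) * n) = n - t * (γ + γ / 24) * n := by
      field_simp; ring
    linarith
  have hup : (A.card : ℝ) ≤ n / (2 * ((k : ℝ) - ℓ)) + η * n := by
    have h1 : ∑ i, h i ≤ K * (η * w) :=
      (Finset.sum_le_card_nsmul _ _ _ fun i _ => hsingle i).trans_eq (by simp)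
    have h2 : (K : ℝ) * w ≤ 2 * n := by
      refine hKw.trans ?_
      have : 1 / (2 * (k : ℝ)) ≤ 1 := by
        rw [div_le_one (by positivity)]
        have : (3 : ℝ) ≤ k := by exact_mod_cast hk
        linarith
      nlinarith
    have h3 : t * (A.card : ℝ) ≤ n + 2 * (η * n) := by
      have := mul_le_mul_of_nonneg_left h2 hη0.le
      linarith
    rw [← ht']
    have h4 : (t : ℝ) * (n / t + η * n) = n + t * (η * n) := by field_simp
    refine le_of_mul_le_mul_left (a := (t : ℝ)) ?_ (by linarith)
    rw [h4]
    have : 2 * (η * n) ≤ t * (η * n) := mul_le_mul_of_nonneg_right ht2 (by positivity)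
    linarith
  refine isExtremal_of_card_tuples_le (by omega) (by omega) H hA hη0.le hup ?_
  have hnk : n ^ k = n ^ (k - 1) * n := by rw [← pow_succ]; congr 1; omega
  have hwk : (K : ℝ) ^ k * (k * w ^ (k - 1) * ((k + 1) * (η * w))) =
      k * (k + 1) * η * (K * w) ^ k := by
    have : (w : ℝ) ^ k = w ^ (k - 1) * w := by rw [← pow_succ]; congr 1; omega
    rw [mul_pow, this]; ring
  have hE : (K : ℝ) ^ k * (γ / (K : ℝ) ^ k * n ^ k) = γ * n ^ k := by field_simp
  have hfac : (k : ℝ) ^ 2 * t ≤ 6 * k.factorial := by exact_mod_cast sq_mul_le_factorial hk hℓ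
  have hfac6 : (6 : ℝ) ≤ k.factorial := by
    exact_mod_cast Nat.factorial_le hk
  have h1 : k * (k + 1) * η * (K * w : ℝ) ^ k ≤ k * (k + 1) * η * (2 * n ^ k) := by gcongr
  have h2 : (k : ℝ) ^ 2 * (K * w : ℝ) ^ (k - 1) * (n - t * A.card) ≤
      12 * k.factorial * (γ + γ / 24) * n ^ k := by
    calc (k : ℝ) ^ 2 * (K * w : ℝ) ^ (k - 1) * (n - t * A.card)
        ≤ (k : ℝ) ^ 2 * (K * w : ℝ) ^ (k - 1) * (t * (γ + γ / 24) * n) := by gcongr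
      _ ≤ (k : ℝ) ^ 2 * (2 * n ^ (k - 1)) * (t * (γ + γ / 24) * n) := by gcongr
      _ = (k : ℝ) ^ 2 * t * (2 * (γ + γ / 24) * n ^ k) := by rw [hnk]; ring
      _ ≤ 6 * k.factorial * (2 * (γ + γ / 24) * n ^ k) := by gcongr
      _ = 12 * k.factorial * (γ + γ / 24) * n ^ k := by ring
  have h3 : (2 * k * (k + 1) + k) * η = γ := by rw [hη]; field_simp
  have h4 : k * (k + 1) * η * (2 * n ^ k) + k * η * n ^ k = γ * n ^ k := by
    rw [← h3]; ring
  have h5 : 0 ≤ γ * n ^ k := by positivity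
  have h6 : 6 * (γ * n ^ k) ≤ k.factorial * (γ * n ^ k) := by gcongr
  rw [mul_add, hE, hwk, hsum] at hcount
  -- In units of `k! * γ * n ^ k`: the term in `n - t |A|` gives `12 * (25 / 24) = 12.5`, and the
  -- remaining `2 * γ * n ^ k` counts at most `1 / 3` since `k! ≥ 6`. The total is below `14`.
  nlinarith

theorem exists_covered_step.{u} {k ℓ : ℕ} (hk : 3 ≤ k) (hℓ : 1 ≤ ℓ) (hℓk : 2 * ℓ < k) {γ α : ℝ}
    (hγ : 0 < γ) (hα : 0 < α) : ∃ c : ℝ, 0 < c ∧ ∃ (n₀ : ℕ) (g : ℕ → ℕ),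
      ∀ (V : Type u) [DecidableEq V] (H : KGraph V k), n₀ < H.verts.card →
      (1 / (2 * ((k : ℝ) - ℓ)) - γ) * (H.verts.card : ℝ) ≤ (H.minDegree (k - 1) : ℝ) →
      ¬ H.IsExtremal ℓ (14 * γ) → ∀ (p : ℕ) (X : Finset V), H.Covered ℓ p X →
      α * H.verts.card ≤ (H.verts \ X).card →
      ∃ X', H.Covered ℓ (g p) X' ∧ X.card + c * H.verts.card ≤ X'.card := by
  have hk0 : (0 : ℝ) < k := by exact_mod_cast (show 0 < k by omega)
  set t : ℕ := 2 * (k - ℓ) with ht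
  have ht' : (t : ℝ) = 2 * ((k : ℝ) - ℓ) := by
    rw [ht, Nat.cast_mul, Nat.cast_sub (by omega)]; norm_num
  have ht2 : (2 : ℝ) ≤ t := by exact_mod_cast (show 2 ≤ t by omega)
  have ht0 : (0 : ℝ) < t := by linarith
  obtain ⟨β, hβ⟩ : ∃ β : ℝ, β = γ / 24 / 2 * α ^ (k - 1) := ⟨_, rfl⟩
  have hβ0 : 0 < β := by rw [hβ]; positivity
  obtain ⟨η, hη⟩ : ∃ η : ℝ, η = γ / (2 * k * (k + 1) + k) := ⟨_, rfl⟩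
  have hη0 : 0 < η := by rw [hη]; positivity
  -- So many parts that the union of any `k` of them is small compared with `β * n`, as
  -- `exists_cover_of_large_degree` requires.
  obtain ⟨K, hK⟩ := exists_nat_gt (4 * (k : ℝ) ^ 2 * (2 * k + 1) / β)
  have hK0 : (0 : ℝ) < K := lt_of_le_of_lt (by positivity) hK
  have hK1 : 0 < K := by exact_mod_cast hK0
  rw [div_lt_iff₀ hβ0] at hK
  obtain ⟨ε₂, hε₂⟩ : ∃ ε₂ : ℝ, ε₂ = η / (4 * t * K) := ⟨_, rfl⟩
  have hε₂0 : 0 < ε₂ := by rw [hε₂]; positivity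
  obtain ⟨p₁, hp₁⟩ := exists_cover_of_large_degree.{u} hℓ hℓk hβ0 hε₂0
  obtain ⟨p₂, hp₂⟩ := exists_cover_sparse.{u} hℓ hℓk (ε := γ / (K : ℝ) ^ k) (by positivity)
  obtain ⟨n₀, hn₀⟩ := exists_nat_gt ((p₁ : ℝ) + p₂ + (k : ℝ) ^ 2 / (γ / 24 / 2 * α) + 2 * k * K +
    8 * k * K ^ 2 / η)
  refine ⟨η / (2 * K), by positivity, n₀, fun p => K * p + p₁ + p₂, ?_⟩
  intro V _ H hn hdeg hext p X hX hXα
  have hn' : (n₀ : ℝ) < H.verts.card := by exact_mod_cast hn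
  have pos₁ : (0 : ℝ) ≤ p₁ := Nat.cast_nonneg _
  have pos₂ : (0 : ℝ) ≤ p₂ := Nat.cast_nonneg _
  have pos₃ : 0 ≤ (k : ℝ) ^ 2 / (γ / 24 / 2 * α) := by positivity
  have pos₄ : 0 ≤ 2 * (k : ℝ) * K := by positivity
  have pos₅ : 0 ≤ 8 * (k : ℝ) * K ^ 2 / η := by positivity
  have hnp₁ : p₁ < H.verts.card := by
    have : (p₁ : ℝ) < H.verts.card := by linarith
    exact_mod_cast this
  have hnp₂ : p₂ < H.verts.card := by
    have : (p₂ : ℝ) < H.verts.card := by linarith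
    exact_mod_cast this
  set n : ℝ := (H.verts.card : ℝ) with hndef
  have hn3 : (k : ℝ) ^ 2 < γ / 24 / 2 * (α * n) := by
    have : (k : ℝ) ^ 2 / (γ / 24 / 2 * α) < n := by linarith
    rw [div_lt_iff₀ (by positivity)] at this
    linarith
  have hn4 : 2 * (k : ℝ) * K ≤ n := by linarith
  have hn5 : 8 * (k : ℝ) * K ^ 2 ≤ η * n := by
    have : 8 * (k : ℝ) * K ^ 2 / η < n := by linarith
    rw [div_lt_iff₀ hη0] at this
    linarith
  have hn0 : 0 < n := by linarith [show 0 < 2 * (k : ℝ) * K by positivity]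
  obtain ⟨w, hw⟩ : ∃ w, w = H.verts.card / K + 1 := ⟨_, rfl⟩
  have hnKw : H.verts.card ≤ K * w := by
    rw [hw]; exact (Nat.lt_mul_div_succ _ hK1).le
  have hKwn : (K * w : ℝ) ≤ n + K := by
    have : K * w ≤ H.verts.card + K := by
      rw [hw, mul_add, mul_one]
      exact Nat.add_le_add_right (Nat.mul_div_le _ _) _
    rw [hndef]
    exact_mod_cast this
  have hnKw' : n ≤ K * w := by rw [hndef]; exact_mod_cast hnKw
  obtain ⟨W, Y, hWw, hWd, hWV, hYW, hYX, hY, hXY⟩ :=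
    hX.exists_partition (by omega) K hX.subset_verts hnKw
  have hU : α * n ≤ ((H.verts \ Finset.univ.biUnion Y).card : ℝ) := by
    refine hXα.trans (Nat.cast_le.2 (Finset.card_le_card (Finset.sdiff_subset_sdiff subset_rfl ?_)))
    exact Finset.biUnion_subset.2 fun i _ => hYX i
  set U := H.verts \ Finset.univ.biUnion Y with hUdef
  have hA := card_large_degree_ge (show 2 ≤ k by omega) H (a := 1 / (2 * ((k : ℝ) - ℓ)) - γ)
    (by
      rw [← ht']
      have : 1 / (t : ℝ) ≤ 1 := by rw [div_le_one ht0]; linarith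
      linarith) hα (show 0 < γ / 24 by positivity) hβ Finset.sdiff_subset hU hn3 hdeg
  set A := H.verts.filter fun v => β * (H.verts.card : ℝ) ^ (k - 1) ≤
      ((H.tuples.filter fun f => f ⟨0, by omega⟩ = v ∧
        ∀ i, i ≠ ⟨0, by omega⟩ → f i ∈ U).card : ℝ) with hAdef
  by_contra! hno
  refine hext (isExtremal_of_no_gain hk hℓ hℓk H hγ hη (hKwn.trans ?_) hK1 hWw hWd hWV
    (Finset.filter_subset _ _) hA fun J hJ => ?_)
  · have : (K : ℝ) ≤ n * (1 / (2 * k)) := by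
      rw [mul_one_div, le_div_iff₀ (by positivity)]; linarith
    linarith
  have hWJ : ((J.biUnion W).card : ℝ) ≤ k * w := by
    have : (J.biUnion W).card ≤ k * w := by
      refine (Finset.card_biUnion_le_card_mul J W w fun i _ => hWw i).trans ?_
      exact Nat.mul_le_mul_right _ hJ
    exact_mod_cast this
  obtain ⟨Z, hZA, hZ, hZc⟩ := hp₁ V H hnp₁ ⟨0, by omega⟩ (A ∩ J.biUnion W) U (J.biUnion W)
    Finset.inter_subset_right
    (fun a ha => (Finset.mem_filter.1 (Finset.mem_inter.1 ha).1).2) (by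
      have h1 : (K : ℝ) ≤ n := by
        have : (K : ℝ) * 1 ≤ K * (2 * k) := by
          gcongr
          have : (3 : ℝ) ≤ k := by exact_mod_cast hk
          linarith
        linarith
      have h2 : 2 * (k : ℝ) * (2 * k + 1) * (K * (J.biUnion W).card) ≤ K * (β * n) := by
        calc 2 * (k : ℝ) * (2 * k + 1) * (K * (J.biUnion W).card)
            ≤ 2 * (k : ℝ) * (2 * k + 1) * (K * (k * w)) := by gcongr
          _ = 2 * (k : ℝ) ^ 2 * (2 * k + 1) * (K * w) := by ring
          _ ≤ 2 * (k : ℝ) ^ 2 * (2 * k + 1) * (2 * n) :=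
              mul_le_mul_of_nonneg_left (by linarith) (by positivity)
          _ = 4 * (k : ℝ) ^ 2 * (2 * k + 1) * n := by ring
          _ ≤ K * β * n := by gcongr
          _ = K * (β * n) := by ring
      refine le_of_mul_le_mul_left (a := (K : ℝ)) ?_ hK0
      linarith)
  obtain ⟨Q, hQA, hQ, hQc⟩ := hp₂ V H hnp₂ (J.biUnion W \ A)
  refine ⟨Q, hQc, ?_⟩
  obtain ⟨X', hX', hcard⟩ := covered_swap hWd hYW hY J hZ hQ hZA hQA
  have h1 := hno X' hX'
  have h2 : ((A ∩ J.biUnion W).card : ℝ) = ∑ i ∈ J, ((A ∩ W i).card : ℝ) := by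
    rw [Finset.inter_biUnion, Finset.card_biUnion fun i _ j _ hij =>
      Finset.disjoint_of_subset_left Finset.inter_subset_right
        (Finset.disjoint_of_subset_right Finset.inter_subset_right (hWd i j hij))]
    push_cast; rfl
  have h3 : ∑ i, ((Y i).card : ℝ) + Z.card + Q.card ≤ X'.card + ∑ i ∈ J, ((W i).card : ℝ) := by
    exact_mod_cast hcard
  have h4 : (X.card : ℝ) ≤ ∑ i, ((Y i).card : ℝ) + 2 * k * K := by exact_mod_cast hXY
  rw [Finset.sum_sub_distrib, ← Finset.mul_sum, ← h2]
  -- The allowance `η * w ≥ η * n / K` splits into four quarters: one for uncovered vertices of `A`,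
  -- one for cutting the paths, two for the gain `c * n` ruled out by `hno`.
  have h5 : (t : ℝ) * (ε₂ * n) = η * n / (4 * K) := by rw [hε₂]; field_simp
  have h6 : 2 * (k : ℝ) * K ≤ η * n / (4 * K) := by
    rw [le_div_iff₀ (by positivity)]; linarith
  have h7 : η / (2 * K) * n = η * n / (4 * K) + η * n / (4 * K) := by field_simp; ring
  have h8 : 4 * (η * n / (4 * K)) ≤ η * w := by
    rw [show 4 * (η * n / (4 * K)) = η * n / K by field_simp, div_le_iff₀ hK0]
    have := mul_le_mul_of_nonneg_left hnKw' hη0.le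
    linarith
  rw [h5] at hZc
  rw [h7] at h1
  linarith

end KGraph

/-! ### Iterating the exchange -/

theorem lemma2p3 (k ℓ : ℕ) (hk : 3 ≤ k) (hℓ : 1 ≤ ℓ) (hℓk : 2 * ℓ < k)
    (γ₃ α : ℝ) (hγ₃ : 0 < γ₃) (hα : 0 < α) :
    ∃ p n₀ : ℕ, ∀ (V : Type*) [DecidableEq V] (H : KGraph V k),
      n₀ < H.verts.card →
      (1 / (2 * ((k : ℝ) - ℓ)) - γ₃) * (H.verts.card : ℝ) ≤ (H.minDegree (k - 1) : ℝ) →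
      (∃ F : Finset (KGraph V k),
        F.card ≤ p ∧
        (∀ P ∈ F, P.IsSubgraph H ∧ P.IsPath ℓ) ∧
        (∀ P ∈ F, ∀ Q ∈ F, P ≠ Q → Disjoint P.verts Q.verts) ∧
        ((H.verts \ F.biUnion KGraph.verts).card : ℝ) ≤ α * (H.verts.card : ℝ)) ∨
      H.IsExtremal ℓ (14 * γ₃) := by
  obtain ⟨c, hc, n₀, g, hstep⟩ := KGraph.exists_covered_step hk hℓ hℓk hγ₃ hα
  obtain ⟨N, hN⟩ := exists_nat_gt (1 / c)
  rw [div_lt_iff₀ hc] at hN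
  -- The summand `p` makes `π` monotone, so a cover that is already good enough stays admissible in
  -- later rounds.
  let π : ℕ → ℕ := fun j => (fun p => p + g p)^[j] 0
  refine ⟨π N, n₀, fun V _ H hn hdeg => or_iff_not_imp_right.2 fun hext => ?_⟩
  have main : ∀ j : ℕ, ∃ X, H.Covered ℓ (π j) X ∧
      (((H.verts \ X).card : ℝ) ≤ α * H.verts.card ∨ j * (c * H.verts.card) ≤ X.card) := by
    intro j
    induction j with
    | zero => exact ⟨∅, .nil _, Or.inr (by simp)⟩
    | succ j ih =>
      have hπ : π (j + 1) = π j + g (π j) := Function.iterate_succ_apply' _ _ _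
      obtain ⟨X, hX, hXc⟩ := ih
      rcases le_total ((H.verts \ X).card : ℝ) (α * H.verts.card) with h | h
      · exact ⟨X, hX.mono (by omega), Or.inl h⟩
      rcases hXc with h' | h'
      · exact ⟨X, hX.mono (by omega), Or.inl h'⟩
      obtain ⟨X', hX', hXX'⟩ := hstep V H hn hdeg hext _ X hX h
      refine ⟨X', hX'.mono (by omega), Or.inr ?_⟩
      push_cast
      linarith
  obtain ⟨X, hX, hXc⟩ := main N
  have hX' : ((H.verts \ X).card : ℝ) ≤ α * H.verts.card := by
    refine hXc.resolve_right fun h => ?_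
    have h1 : (X.card : ℝ) ≤ H.verts.card := by exact_mod_cast Finset.card_le_card hX.subset_verts
    have h2 : (0 : ℝ) < H.verts.card := by exact_mod_cast (Nat.zero_le n₀).trans_lt hn
    nlinarith
  obtain ⟨F, hF, hpath, hdis, rfl⟩ := hX.exists_family (by omega)
  exact ⟨F, hF, hpath, hdis, hX'⟩
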